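/- **Setting.** Let $\mathcal S,\mathcal A$ be measurable spaces, $p(\cdot\mid s,a)$ a Markov transition kernel from $\mathcal S\times\mathcal A$ to $\mathcal S$, $\bar\pi$ a known behavior policy and $\eta$ a positive probability measure on $\mathcal A$; $\bar\pi(\cdot\mid s)$ and $\eta$ have positive densities $\bar\pi(a\mid s)$, $\eta(a)$ with respect to a common $\sigma$-finite measure. Let $\xi$ be a stationary state distribution under $\bar\pi$. The worst-case mixing time $t_{mix}=\max_\pi\min\{t\ge 1:\|p^{t',\pi}(\cdot\mid s_0)-\nu^\pi\|_{TV}\le 1/4\ \forall s_0\in\mathcal S,\ t'\ge t\}$ is assumed finite ($\pi$ ranges over stationary randomized policies, $p^{t,\pi}$ is the $t$-step state kernel under $\pi$, $\nu^\pi$ its invariant distribution). Let $\mathcal H_S,\mathcal H_A$ be reproducing kernel Hilbert spaces of measurable functions on $\mathcal S,\mathcal A$ with kernels $K_S,K_A$; let $\phi=(\phi_1,\dots,\phi_{d_S})$ be an orthonormal basis of $\mathcal H_S$ (so $K_S(s,s')=\phi(s)^\top\phi(s')$) and $\psi=(\psi_1,\dots,\psi_{d_A})$ a basis of $\mathcal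 H_A$ that is orthonormal in $L^2(\eta)$. Assume that $(\mathbb Pf)(s,a)=\int f(s')\,p(ds'\mid s,a)$ has Tucker rank at most $(r,l,m)$: there are $c_{ijk}\in\mathbb R$, $u_i,w_k\in\mathcal H_S$, $v_j\in\mathcal H_A$ with $(\mathbb Pf)(s,a)=\sum_{i\le r,\,j\le l,\,k\le m}c_{ijk}u_i(s)v_j(a)\langle f,w_k\rangle_{\mathcal H_S}$ for all $f\in\mathcal H_S$. Let $\mathbf P\in\mathbb R^{d_S\times d_A\times d_S}$ be the tensor with $\mathbf P\times_1\phi(s)^\top\times_2\psi(a)^\top=\mathbb E[\phi(s')\mid s,a]$ for all $s,a$, and put $\Sigma=\int\phi\phi^\top d\xi$ (assumed invertible), $K_{max}=\max\{\sup_sK_S(s,s),\sup_aK_A(a,a)\}<\infty$, $\kappa=\sup_{s,a}\eta(a)/\bar\pi(a\mid s)<\infty$, $\bar\mu=\|\mathbb E_{S\sim\xi}[K_S(S,S)\phi(S)\phi(S)^\top]\|_\sigma$, $\bar\lambda=\sup_{\|u\|=\|v\|=\|w\|=1}\mathbb E[((u^\top\phi(S))(v^\top\psi(A))(w^\top\phi(S')))^2]$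 with $(S,A)\sim\xi\times\eta$, $S'\sim p(\cdot\mid S,A)$, and $\sigma=\sup_{\|w\|\le1}\sigma_m(\mathbf P\times_1w^\top)$, assumed positive; $\|\cdot\|_\sigma$ is the spectral norm and $\sigma_m$ the $m$-th singular value. **Estimator.** The data are the first $n$ transitions $(s_i,a_i,s_i')$, $s_i'=s_{i+1}$, of one sample path generated by $\bar\pi$ from an arbitrary initial distribution. Let $\bar{\mathbf F}=\frac1n\sum_i\frac{\eta(a_i)}{\bar\pi(a_i\mid s_i)}\phi(s_i)\circ\psi(a_i)\circ\phi(s_i')$, let $\hat{\mathbf F}$ be any minimizer of $\|\mathbf Q-\bar{\mathbf F}\|_\sigma$ over tensors $\mathbf Q$ of Tucker rank at most $(r,l,m)$, $\hat\Sigma=\frac1n\sum_i\phi(s_i)\phi(s_i)^\top$, and $\hat{\mathbf P}=\hat{\mathbf F}\times_1\hat\Sigma^{-1}=\hat{\mathbf C}\times_1\hat U_1\times_2\hat U_2\times_3\hat U_3$ any factorization with $\hat{\mathbf C}\in\mathbb R^{r\times l\times m}$ and column-wise orthonormal $\hat U_k$. Put $\hat\Phi(s,a)=\hat{\mathbf C}\times_1(\hat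 U_1^\top\phi(s))^\top\times_2(\hat U_2^\top\psi(a))^\top\in\mathbb R^m$. Let $\{\hat A_i\}_{i\le n_s},\{\hat B_j\}_{j\le n_a},\{\hat z_{ij}\}$ be any minimizer of $\sum_{i,j}\int_{A_i\times B_j}\|\hat\Phi(s,a)-z_{ij}\|^2\,d\xi(s)\,d\eta(a)$ over measurable partitions of $\mathcal S$ and $\mathcal A$ and vectors $z_{ij}\in\mathbb R^m$, and put $\hat q_{ij}=\hat z_{ij}^\top\hat U_3^\top\phi(\cdot)\in\mathcal H_S$. For partitions $\{A_i\}_{i\le n_s},\{B_j\}_{j\le n_a}$ let $L(\{A_i,B_j,q_{ij}\})=\sum_{i,j}\int_{A_i\times B_j}\|p(\cdot\mid s,a)-q_{ij}\|_{\mathcal H_S}^2\,d\xi(s)\,d\eta(a)$, where a probability distribution enters the $\mathcal H_S$-norm through its mean embedding (the element of $\mathcal H_S$ representing $f\mapsto\int f$), and let $L^*$ be the infimum of $L$ over all measurable partitions into $n_s$ and $n_a$ blocks and all probability distributions $q_{ij}$ on $\mathcal S$. **Theorem.** There is an absolute constant $C>0$ such that, for every $\delta\in(0,1)$ and all $n$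 at least a threshold that depends only on $d_S,d_A,t_{mix},\|\Sigma^{-1}\|_\sigma,\bar\mu,K_{max},\kappa,\bar\lambda,\delta$, with probability at least $1-\delta$, $$L(\{\hat A_i,\hat B_j,\hat q_{ij}\})\le C\,\frac{\|\Sigma^{-1}\|_\sigma\,rlm\,\bigl(1+\frac{2\bar\lambda\|\Sigma^{-1}\|_\sigma^2}{\sigma^2}\bigr)}{\max\{r,l,m\}}\cdot\frac{\bar\lambda\,(\log(2t_{mix}/\delta)+d_S+d_A)\,(\kappa+\bar\mu\|\Sigma^{-1}\|_\sigma^2)}{(n/t_{mix})\,\log^{-2}(n/t_{mix})}+4L^*.$$ -/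

import Mathlib

open MeasureTheory ProbabilityTheory
open scoped NNReal ENNReal Matrix

namespace TensorMDP

/-! ### Order-three tensors -/

/-- Real tensors of size `p × q × k`. -/
abbrev Tensor3 (p q k : ℕ) := Fin p → Fin q → Fin k → ℝ

section Tensors

variable {p q k p' q' k' : ℕ}

/-- The mode-1 product `X ×₁ U`. -/
def mode1 (X : Tensor3 p q k) (U : Matrix (Fin p') (Fin p) ℝ) : Tensor3 p' q k :=
  fun a j c => ∑ i, X i j c * U a i

/-- The mode-2 product `X ×₂ U`. -/
def mode2 (X : Tensor3 p q k) (U : Matrix (Fin q') (Fin q) ℝ) : Tensor3 p q' k :=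
  fun i b c => ∑ j, X i j c * U b j

/-- The mode-3 product `X ×₃ U`. -/
def mode3 (X : Tensor3 p q k) (U : Matrix (Fin k') (Fin k) ℝ) : Tensor3 p q k' :=
  fun i j d => ∑ c, X i j c * U d c

/-- The matrix `X ×₁ wᵀ`. -/
def slice1 (X : Tensor3 p q k) (w : Fin p → ℝ) : Matrix (Fin q) (Fin k) ℝ :=
  Matrix.of fun j c => ∑ i, X i j c * w i

/-- The vector `X ×₁ uᵀ ×₂ vᵀ`. -/
def contract12 (X : Tensor3 p q k) (u : Fin p → ℝ) (v : Fin q → ℝ) : Fin k → ℝ :=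
  fun c => ∑ i, ∑ j, X i j c * u i * v j

/-- The rank-one tensor `u ∘ v ∘ w`. -/
def outer3 (u : Fin p → ℝ) (v : Fin q → ℝ) (w : Fin k → ℝ) : Tensor3 p q k :=
  fun i j c => u i * v j * w c

/-- The matricizations of a tensor along its three modes. -/
def matricize1 (X : Tensor3 p q k) : Matrix (Fin p) (Fin q × Fin k) ℝ :=
  Matrix.of fun i x => X i x.1 x.2

def matricize2 (X : Tensor3 p q k) : Matrix (Fin q) (Fin p × Fin k) ℝ :=
  Matrix.of fun j x => X x.1 j x.2

def matricize3 (X : Tensor3 p q k) : Matrix (Fin k) (Fin p × Fin q) ℝ :=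
  Matrix.of fun c x => X x.1 x.2 c

/-- `Tucker-Rank(X) ≤ (r, l, m)`. -/
def TuckerRankLE (X : Tensor3 p q k) (r l m : ℕ) : Prop :=
  (matricize1 X).rank ≤ r ∧ (matricize2 X).rank ≤ l ∧ (matricize3 X).rank ≤ m

/-- The spectral norm of a tensor, `sup ⟨X, u ∘ v ∘ w⟩` over unit vectors. -/
noncomputable def tensorNorm (X : Tensor3 p q k) : ℝ :=
  sSup {x : ℝ | ∃ (u : EuclideanSpace ℝ (Fin p)) (v : EuclideanSpace ℝ (Fin q))
    (w : EuclideanSpace ℝ (Fin k)), ‖u‖ = 1 ∧ ‖v‖ = 1 ∧ ‖w‖ = 1 ∧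
    x = ∑ i, ∑ j, ∑ c, X i j c * outer3 u v w i j c}

/-- The spectral norm of a square matrix (the Euclidean operator norm). -/
noncomputable def specNorm {d : ℕ} (T : Matrix (Fin d) (Fin d) ℝ) : ℝ :=
  ‖Matrix.toEuclideanCLM (𝕜 := ℝ) T‖

/-- `sup_{‖w‖ ≤ 1} σ_m (X ×₁ wᵀ)`, with `σ_m` the `m`-th largest singular value.
(Mathlib numbers singular values from `0`.) -/
noncomputable def sliceSingularValue (X : Tensor3 p q k) (m : ℕ) : ℝ :=
  sSup {x : ℝ | ∃ w : EuclideanSpace ℝ (Fin p), ‖w‖ ≤ 1 ∧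
    x = (Matrix.toEuclideanLin (slice1 X w)).singularValues (m - 1)}

/-- `X = G ×₁ U₁ ×₂ U₂ ×₃ U₃` with column-wise orthonormal factors. -/
def IsTuckerFactorization (X : Tensor3 p q k) {r l m : ℕ} (G : Tensor3 r l m)
    (U₁ : Matrix (Fin p) (Fin r) ℝ) (U₂ : Matrix (Fin q) (Fin l) ℝ)
    (U₃ : Matrix (Fin k) (Fin m) ℝ) : Prop :=
  U₁ᵀ * U₁ = 1 ∧ U₂ᵀ * U₂ = 1 ∧ U₃ᵀ * U₃ = 1 ∧ X = mode3 (mode2 (mode1 G U₁) U₂) U₃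

/-- `Q` minimizes `‖Q - X‖` in spectral norm among the tensors of Tucker rank at most
`(r, l, m)`. -/
def IsLowRankApprox (X : Tensor3 p q k) (r l m : ℕ) (Q : Tensor3 p q k) : Prop :=
  TuckerRankLE Q r l m ∧
    ∀ Q' : Tensor3 p q k, TuckerRankLE Q' r l m → tensorNorm (Q - X) ≤ tensorNorm (Q' - X)

end Tensors

/-! ### The decision process, the behavior policy and the data -/

/-- A transition kernel `p(· | s, a)`, a behavior policy `π̄` and a positive probability measure `η`
on actions, both given by their densities with respect to a base measure on actions, and a
stationary state distribution `ξ` under `π̄`. (The reward plays no role.)  Positivity of the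
density of `π̄` only says that the importance weights `η(a) / π̄(a | s)` make sense. -/
structure Model (S A : Type*) [MeasurableSpace S] [MeasurableSpace A] where
  trans : Kernel (S × A) S
  trans_markov : IsMarkovKernel trans
  base : Measure A
  base_sigmaFinite : SigmaFinite base
  etaDens : A → ℝ≥0
  etaDens_measurable : Measurable etaDens
  etaDens_pos : ∀ a, 0 < etaDens a
  etaDens_lintegral : ∫⁻ a, etaDens a ∂base = 1
  policy : Kernel S A
  policy_markov : IsMarkovKernel policy
  piDens : S → A → ℝ≥0
  piDens_measurable : Measurable (Function.uncurry piDens)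
  piDens_pos : ∀ s a, 0 < piDens s a
  policy_eq : ∀ s, policy s = base.withDensity fun a => (piDens s a : ℝ≥0∞)
  xi : Measure S
  xi_prob : IsProbabilityMeasure xi
  xi_invariant : Kernel.Invariant (trans ∘ₖ (Kernel.id ×ₖ policy)) xi

namespace Model

variable {S A : Type*} [MeasurableSpace S] [MeasurableSpace A] (M : Model S A)

/-- The probability measure `η(a) da`. -/
noncomputable def eta : Measure A := M.base.withDensity fun a => (M.etaDens a : ℝ≥0∞)

/-- The importance weight `η(a) / π̄(a | s)`. -/
noncomputable def weight (s : S) (a : A) : ℝ := (M.etaDens a : ℝ) / (M.piDens s a : ℝ)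

/-- `κ = sup_{s, a} η(a) / π̄(a | s)`. -/
noncomputable def kappa : ℝ := ⨆ x : S × A, M.weight x.1 x.2

/-- The state kernel `p^π(· | s) = ∫ π(da | s) p(· | s, a)`. -/
noncomputable def stateKernel (π : Kernel S A) : Kernel S S := M.trans ∘ₖ (Kernel.id ×ₖ π)

/-- Under every (stationary, randomized) policy there is an invariant distribution which, from
time `t` on and for every initial state, is within total variation `1/4` of the state's law. -/
def MixesBy (t : ℕ) : Prop :=
  ∀ π : Kernel S A, IsMarkovKernel π →
    ∃ ν : Measure S, IsProbabilityMeasure ν ∧ Kernel.Invariant (M.stateKernel π) ν ∧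
      ∀ (s₀ : S) (t' : ℕ), t ≤ t' → ∀ B : Set S, MeasurableSet B →
        |((M.stateKernel π ^ t') s₀).real B - ν.real B| ≤ 1 / 4

/-- The worst-case mixing time is finite. -/
def HasFiniteMixingTime : Prop := ∃ t : ℕ, 1 ≤ t ∧ M.MixesBy t

/-- The worst-case mixing time. -/
noncomputable def tmix : ℕ := sInf {t : ℕ | 1 ≤ t ∧ M.MixesBy t}

/-- The history `(s₀, a₀, …, s_{t-1}, a_{t-1}, s_t)`. -/
def history {Ω : Type*} (X : ℕ → Ω → S) (U : ℕ → Ω → A) (t : ℕ) (ω : Ω) :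
    (Fin t → S × A) × S :=
  (fun i => (X i ω, U i ω), X t ω)

/-- The states `X t` and actions `U t` form a sample path generated by the behavior policy, from an
arbitrary initial distribution: given the past, `U t` has law `π̄(· | X t)` and `X (t + 1)` has law
`p(· | X t, U t)`. -/
def IsSamplePath {Ω : Type*} [MeasurableSpace Ω] (Pr : Measure Ω)
    (X : ℕ → Ω → S) (U : ℕ → Ω → A) : Prop :=
  (∀ t, Measurable (X t)) ∧ (∀ t, Measurable (U t)) ∧
  (∀ t, Pr.map (fun ω => (history X U t ω, U t ω)) =
    (Pr.map (history X U t)) ⊗ₘ (M.policy.comap (fun h => h.2) measurable_snd)) ∧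
  (∀ t, Pr.map (fun ω => ((history X U t ω, U t ω), X (t + 1) ω)) =
    (Pr.map (fun ω => (history X U t ω, U t ω))) ⊗ₘ
      (M.trans.comap (fun h => (h.1.2, h.2)) (by fun_prop)))

end Model

/-! ### Kernel spaces and features -/

section Features

variable {S A : Type*} [MeasurableSpace S] [MeasurableSpace A]
variable {HS : Type*} [NormedAddCommGroup HS] [InnerProductSpace ℝ HS] [CompleteSpace HS]
  [RKHS ℝ HS S ℝ]
variable {HA : Type*} [NormedAddCommGroup HA] [InnerProductSpace ℝ HA] [CompleteSpace HA]
  [RKHS ℝ HA A ℝ]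
variable {dS dA : ℕ}

/-- The diagonal `K(x, x)` of the kernel of a reproducing kernel Hilbert space. -/
noncomputable def kernelDiag {X : Type*} (H : Type*) [NormedAddCommGroup H] [InnerProductSpace ℝ H]
    [CompleteSpace H] [RKHS ℝ H X ℝ] (x : X) : ℝ :=
  RKHS.kernel H x x (1 : ℝ)

/-- The mean embedding `∫ K(s, ·) dν(s)` of a probability measure `ν`, the element of `H` that
represents `f ↦ ∫ f dν`. -/
noncomputable def meanEmbedding (H : Type*) [NormedAddCommGroup H] [InnerProductSpace ℝ H]
    [CompleteSpace H] [RKHS ℝ H S ℝ] (ν : Measure S) : H :=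
  ∫ s, RKHS.kerFun H s (1 : ℝ) ∂ν

/-- The feature vector `(b₁(x), …, b_d(x))`. -/
noncomputable def featureVec {X H : Type*} [NormedAddCommGroup H] [InnerProductSpace ℝ H] [RKHS ℝ H X ℝ] {d : ℕ}
    (b : Fin d → H) (x : X) : Fin d → ℝ :=
  fun i => b i x

/-- The transition operator `(ℙf)(s, a) = ∫ f(s') p(ds' | s, a)` on `HS` has Tucker rank at most
`(r, l, m)`: `(ℙf)(s, a) = ∑ c_{ijk} u_i(s) v_j(a) ⟨f, w_k⟩` with `u_i, w_k ∈ HS`, `v_j ∈ HA`. In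
particular `ℙf` lies in the tensor product of `HS` and `HA`. -/
def OperatorTuckerRankLE (M : Model S A) (HS HA : Type*)
    [NormedAddCommGroup HS] [InnerProductSpace ℝ HS] [RKHS ℝ HS S ℝ]
    [NormedAddCommGroup HA] [InnerProductSpace ℝ HA] [RKHS ℝ HA A ℝ] (r l m : ℕ) : Prop :=
  ∃ (c : Tensor3 r l m) (u : Fin r → HS) (v : Fin l → HA) (w : Fin m → HS),
    ∀ (f : HS) (s : S) (a : A),
      ∫ s', f s' ∂(M.trans (s, a)) =
        ∑ i, ∑ j, ∑ k, c i j k * u i s * v j a * inner ℝ f (w k)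

/-- `T ×₁ φ(s)ᵀ ×₂ ψ(a)ᵀ = 𝔼[φ(s') | s, a]` for all `s, a`. -/
def IsTransitionTensor (M : Model S A) (φ : OrthonormalBasis (Fin dS) ℝ HS)
    (ψ : Module.Basis (Fin dA) ℝ HA) (T : Tensor3 dS dA dS) : Prop :=
  ∀ (s : S) (a : A) (k : Fin dS),
    contract12 T (featureVec φ s) (featureVec ψ a) k = ∫ s', φ k s' ∂(M.trans (s, a))

set_option linter.unusedSectionVars false in
/-- There is at most one transition tensor. -/
theorem IsTransitionTensor.unique {M : Model S A} {φ : OrthonormalBasis (Fin dS) ℝ HS}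
    {ψ : Module.Basis (Fin dA) ℝ HA} {T T' : Tensor3 dS dA dS}
    (h : IsTransitionTensor M φ ψ T) (h' : IsTransitionTensor M φ ψ T') : T = T' := by
  have key : ∀ k i, ∑ j, (T i j k - T' i j k) • ψ j = 0 := by
    intro k
    by_contra hne
    push Not at hne
    obtain ⟨i, hi⟩ := hne
    apply hi
    ext a
    have h0 : ∑ i, (∑ j, (T i j k - T' i j k) * ψ j a) • φ i = 0 := by
      ext s
      have e := (h s a k).trans (h' s a k).symm
      have c1 : ∀ f : HS, f s = RKHS.coeCLM ℝ f s := fun f => rfl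
      rw [c1, map_sum]
      simp only [map_smul, Finset.sum_apply, Pi.smul_apply, smul_eq_mul, RKHS.coeCLM_apply,
        RKHS.coe_zero, Pi.zero_apply]
      simp only [contract12, featureVec] at e
      rw [← sub_eq_zero, ← Finset.sum_sub_distrib] at e
      rw [← e]
      refine Finset.sum_congr rfl fun i _ => ?_
      rw [Finset.sum_mul, ← Finset.sum_sub_distrib]
      exact Finset.sum_congr rfl fun j _ => by ring
    have h1 := (Fintype.linearIndependent_iff.mp φ.orthonormal.linearIndependent) _ h0 i
    have c1 : ∀ g : HA, g a = RKHS.coeCLM ℝ g a := fun g => rfl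
    rw [c1, map_sum]
    simpa only [map_smul, Finset.sum_apply, Pi.smul_apply, smul_eq_mul, RKHS.coeCLM_apply,
      RKHS.coe_zero, Pi.zero_apply] using h1
  funext i j k
  exact sub_eq_zero.mp ((Fintype.linearIndependent_iff.mp ψ.linearIndependent) _ (key k i) j)

/-- The transition tensor `P`: the tensor with `P ×₁ φ(s)ᵀ ×₂ ψ(a)ᵀ = 𝔼[φ(s') | s, a]`. -/
noncomputable def transitionTensor (M : Model S A) (φ : OrthonormalBasis (Fin dS) ℝ HS)
    (ψ : Module.Basis (Fin dA) ℝ HA) : Tensor3 dS dA dS :=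
  Classical.epsilon fun T => IsTransitionTensor M φ ψ T

/-- `ψ` is orthonormal in `L²(η)`. -/
def IsL2Orthonormal (M : Model S A) (ψ : Module.Basis (Fin dA) ℝ HA) : Prop :=
  ∀ i j, ∫ a, ψ i a * ψ j a ∂M.eta = if i = j then 1 else 0

/-- All functions of both kernel spaces are measurable. -/
def MeasurableSpaces (S A HS HA : Type*) [MeasurableSpace S] [MeasurableSpace A]
    [NormedAddCommGroup HS] [InnerProductSpace ℝ HS] [RKHS ℝ HS S ℝ]
    [NormedAddCommGroup HA] [InnerProductSpace ℝ HA] [RKHS ℝ HA A ℝ] : Prop :=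
  (∀ f : HS, Measurable fun s : S => f s) ∧ ∀ g : HA, Measurable fun a : A => g a

/-- `K_max` and `κ` are finite. -/
def BoundedModel (M : Model S A) (HS HA : Type*)
    [NormedAddCommGroup HS] [InnerProductSpace ℝ HS] [CompleteSpace HS] [RKHS ℝ HS S ℝ]
    [NormedAddCommGroup HA] [InnerProductSpace ℝ HA] [CompleteSpace HA] [RKHS ℝ HA A ℝ] : Prop :=
  BddAbove (Set.range fun s : S => kernelDiag HS s) ∧
  BddAbove (Set.range fun a : A => kernelDiag HA a) ∧
  BddAbove (Set.range fun x : S × A => M.weight x.1 x.2)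

/-- `K_max = max {sup_s K_S(s, s), sup_a K_A(a, a)}`. -/
noncomputable def Kmax (S A HS HA : Type*)
    [NormedAddCommGroup HS] [InnerProductSpace ℝ HS] [CompleteSpace HS] [RKHS ℝ HS S ℝ]
    [NormedAddCommGroup HA] [InnerProductSpace ℝ HA] [CompleteSpace HA] [RKHS ℝ HA A ℝ] : ℝ :=
  max (⨆ s : S, kernelDiag HS s) (⨆ a : A, kernelDiag HA a)

/-- `Σ = ∫ φ(s) φ(s)ᵀ dξ(s)`. -/
noncomputable def covariance (M : Model S A) (φ : OrthonormalBasis (Fin dS) ℝ HS) :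
    Matrix (Fin dS) (Fin dS) ℝ :=
  Matrix.of fun i j => ∫ s, φ i s * φ j s ∂M.xi

/-- `μ̄ = ‖𝔼 [K_S(S, S) φ(S) φ(S)ᵀ]‖`, `S ∼ ξ`. -/
noncomputable def muBar (M : Model S A) (φ : OrthonormalBasis (Fin dS) ℝ HS) : ℝ :=
  specNorm (Matrix.of fun i j => ∫ s, kernelDiag HS s * (φ i s * φ j s) ∂M.xi)

/-- `λ̄ = sup_{u, v, w} 𝔼 [((uᵀφ(S)) (vᵀψ(A)) (wᵀφ(S')))²]` over unit vectors, with
`(S, A) ∼ ξ × η` and `S' ∼ p(· | S, A)`. -/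
noncomputable def lambdaBar (M : Model S A) (φ : OrthonormalBasis (Fin dS) ℝ HS)
    (ψ : Module.Basis (Fin dA) ℝ HA) : ℝ :=
  sSup {x : ℝ | ∃ (u : EuclideanSpace ℝ (Fin dS)) (v : EuclideanSpace ℝ (Fin dA))
    (w : EuclideanSpace ℝ (Fin dS)), ‖u‖ = 1 ∧ ‖v‖ = 1 ∧ ‖w‖ = 1 ∧
    x = ∫ y : (S × A) × S, ((u ⬝ᵥ featureVec φ y.1.1) * (v ⬝ᵥ featureVec ψ y.1.2) *
      (w ⬝ᵥ featureVec φ y.2)) ^ 2 ∂((M.xi.prod M.eta) ⊗ₘ M.trans)}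

/-! ### Estimators from the first `n` transitions of a sample path -/

/-- `F̄ = n⁻¹ ∑ᵢ (η(aᵢ) / π̄(aᵢ | sᵢ)) φ(sᵢ) ∘ ψ(aᵢ) ∘ φ(sᵢ')`, with `sᵢ' = s_{i+1}`. -/
noncomputable def empiricalTensor (M : Model S A) (φ : OrthonormalBasis (Fin dS) ℝ HS)
    (ψ : Module.Basis (Fin dA) ℝ HA) (s : ℕ → S) (a : ℕ → A) (n : ℕ) : Tensor3 dS dA dS :=
  (n : ℝ)⁻¹ • ∑ i ∈ Finset.range n, M.weight (s i) (a i) •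
    outer3 (featureVec φ (s i)) (featureVec ψ (a i)) (featureVec φ (s (i + 1)))

/-- `Σ̂ = n⁻¹ ∑ᵢ φ(sᵢ) φ(sᵢ)ᵀ`. -/
noncomputable def empiricalCovariance (φ : OrthonormalBasis (Fin dS) ℝ HS) (s : ℕ → S) (n : ℕ) :
    Matrix (Fin dS) (Fin dS) ℝ :=
  (n : ℝ)⁻¹ • ∑ i ∈ Finset.range n,
    Matrix.vecMulVec (featureVec φ (s i)) (featureVec φ (s i))

/-- The joint embedding `Φ̂(s, a) = Ĉ ×₁ f̂(s)ᵀ ×₂ ĝ(a)ᵀ`, with `f̂(s) = Û₁ᵀ φ(s)` and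
`ĝ(a) = Û₂ᵀ ψ(a)`. -/
noncomputable def jointEmbedding (φ : OrthonormalBasis (Fin dS) ℝ HS)
    (ψ : Module.Basis (Fin dA) ℝ HA) {r l m : ℕ} (G : Tensor3 r l m)
    (U₁ : Matrix (Fin dS) (Fin r) ℝ) (U₂ : Matrix (Fin dA) (Fin l) ℝ) (s : S) (a : A) :
    EuclideanSpace ℝ (Fin m) :=
  WithLp.toLp 2 (contract12 G (U₁ᵀ *ᵥ featureVec φ s) (U₂ᵀ *ᵥ featureVec ψ a))

/-- `q̂(·) = zᵀ Û₃ᵀ φ(·)`, as an element of `HS`. -/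
noncomputable def decode (φ : OrthonormalBasis (Fin dS) ℝ HS) {m : ℕ}
    (U₃ : Matrix (Fin dS) (Fin m) ℝ) (z : EuclideanSpace ℝ (Fin m)) : HS :=
  ∑ k, (U₃ *ᵥ z.ofLp) k • φ k

/-! ### Partitions and clustering -/

/-- `P 0, …, P (k - 1)` are measurable blocks (possibly empty) that partition `X`. -/
def IsPartition {X : Type*} [MeasurableSpace X] {k : ℕ} (P : Fin k → Set X) : Prop :=
  (∀ i, MeasurableSet (P i)) ∧ Pairwise (fun i j => Disjoint (P i) (P j)) ∧ ⋃ i, P i = Set.univ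

/-- The objective
`L({A_i, B_j, q_ij}) = ∑_{ij} ∫_{A_i × B_j} ‖p(· | s, a) - q_ij‖² dξ(s) dη(a)`; distributions enter
the norm of `HS` through their mean embeddings. -/
noncomputable def partitionLoss (M : Model S A) {ns na : ℕ} (P : Fin ns → Set S)
    (Q : Fin na → Set A) (q : Fin ns → Fin na → HS) : ℝ :=
  ∑ i, ∑ j, ∫ x in P i ×ˢ Q j, ‖meanEmbedding HS (M.trans x) - q i j‖ ^ 2 ∂(M.xi.prod M.eta)

/-- The optimal value `L*` over partitions into `ns × na` blocks and probability distributions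
`q_ij`. -/
noncomputable def optimalLoss (M : Model S A) (HS : Type*) [NormedAddCommGroup HS]
    [InnerProductSpace ℝ HS] [CompleteSpace HS] [RKHS ℝ HS S ℝ] (ns na : ℕ) : ℝ :=
  sInf {x : ℝ | ∃ (P : Fin ns → Set S) (Q : Fin na → Set A)
    (q : Fin ns → Fin na → ProbabilityMeasure S), IsPartition P ∧ IsPartition Q ∧
    x = partitionLoss M P Q fun i j => meanEmbedding HS (q i j : Measure S)}

/-- The objective of the empirical clustering problem,
`∑_{ij} ∫_{A_i × B_j} ‖Φ̂(s, a) - z_ij‖² dξ(s) dη(a)`. -/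
noncomputable def clusterLoss (M : Model S A) {m ns na : ℕ}
    (Φ : S → A → EuclideanSpace ℝ (Fin m)) (P : Fin ns → Set S) (Q : Fin na → Set A)
    (z : Fin ns → Fin na → EuclideanSpace ℝ (Fin m)) : ℝ :=
  ∑ i, ∑ j, ∫ x in P i ×ˢ Q j, ‖Φ x.1 x.2 - z i j‖ ^ 2 ∂(M.xi.prod M.eta)

/-- `{A_i, B_j, z_ij}` solves the empirical clustering problem. -/
def IsClusterSolution (M : Model S A) {m ns na : ℕ} (Φ : S → A → EuclideanSpace ℝ (Fin m))
    (P : Fin ns → Set S) (Q : Fin na → Set A)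
    (z : Fin ns → Fin na → EuclideanSpace ℝ (Fin m)) : Prop :=
  IsPartition P ∧ IsPartition Q ∧
  ∀ (P' : Fin ns → Set S) (Q' : Fin na → Set A)
    (z' : Fin ns → Fin na → EuclideanSpace ℝ (Fin m)), IsPartition P' → IsPartition Q' →
    clusterLoss M Φ P Q z ≤ clusterLoss M Φ P' Q' z'

/-- The squared statistical rate
`λ̄ (log(2 t / δ) + d_S + d_A) (κ + μ̄ ‖Σ⁻¹‖²) / ((n / t) log⁻²(n / t))`, `t` the mixing time. -/
noncomputable def squaredRate (M : Model S A) (φ : OrthonormalBasis (Fin dS) ℝ HS)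
    (ψ : Module.Basis (Fin dA) ℝ HA) (δ : ℝ) (n : ℕ) : ℝ :=
  lambdaBar M φ ψ * (Real.log (2 * M.tmix / δ) + dS + dA) *
      (M.kappa + muBar M φ * specNorm (covariance M φ)⁻¹ ^ 2) /
    ((n / M.tmix : ℝ) * (Real.log (n / M.tmix) ^ 2)⁻¹)

end Features

end TensorMDP

namespace TensorMDP

/-! ### Mixing Markov kernels -/

section Mixing

variable {S : Type*} [MeasurableSpace S]

/-! The sample-size threshold may depend on the dimensions, the mixing time, `δ` and the other model
constants, and the claimed rate carries an extra factor `log²(n / t)`. Hence any error bound of the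
form `const / n`, with a constant built only from those quantities, is eventually below the rate:
the growing logarithm absorbs dimension factors, the `1 / δ` of Markov's inequality and all other
losses. This is why second moments suffice and why `C = 1` works.

Probabilistic part: mixing makes the conditional means forget the starting state geometrically, so a
truncated Neumann series approximately solves the Poisson equation (`exists_approx_poisson`).
Averages along the path are then a martingale plus a bounded remainder, and `integral_average_sq_le`
bounds their mean square error by `O(1 / n)`. The constant involves only the conditional first and
second moments, not the supremum of the summand. That matters because `ψ` is normalized in `L²(η)`
only, so its supremum is not an admissible constant. Importance weighting and this normalization
give conditional means at most `Kmax` and second moments at most `Kmax² κ`; the stationary mean of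
the sample tensor is `F = P ×₁ Σ`. One event of probability `1 - δ` makes every entry of `F̄` and
`Σ̂` accurate up to `ε = √(V / (n δ))` (`exists_concentration_event`).

On that event everything is deterministic, hence valid for all minimizers and factorizations at
once. `F` has low rank and competes with `F̂`, so `F̂` is within `O(ε)` of `F`; inverting `Σ̂` keeps
`P̂` within `O(ε)` of `P` (`abs_mode1_inv_sub_le`). Decoding by `Û₃` is an isometry `J`, and `J ∘
Φ̂` is the mean embedding predicted by `P̂`. Two uses of `‖x + y‖² ≤ 2‖x‖² + 2‖y‖²`, one on each
side of the optimality of the clustering, give loss at most `6 D + 4 L*`, where `D = O(ε²)` is the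
mean square embedding error (`IsClusterSolution.partitionLoss_le`).

For the logarithm to win, its coefficient must be positive: `σ > 0` forces `P ≠ 0`, which makes `λ̄`
and `‖Σ⁻¹‖` positive and the ranks at least one. The rank and conditioning factors of the bound are
then at least one. -/

theorem integrable_of_abs_le {X : Type*} [MeasurableSpace X] {μ : Measure X} [IsFiniteMeasure μ]
    {f : X → ℝ} {b : ℝ} (hf : Measurable f) (hb : ∀ x, |f x| ≤ b) : Integrable f μ :=
  Integrable.of_bound hf.aestronglyMeasurable b (.of_forall hb)

theorem abs_integral_le_of_abs_le {X : Type*} [MeasurableSpace X] {μ : Measure X}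
    [IsProbabilityMeasure μ] {f : X → ℝ} {b : ℝ} (hb : ∀ x, |f x| ≤ b) : |∫ x, f x ∂μ| ≤ b := by
  simpa using norm_integral_le_of_norm_le_const (μ := μ) (f := f) (C := b) (.of_forall hb)

/-- If the total variation between `μ` and `ν` is at most `1/2`, then the integrals of `f` differ by
at most half the oscillation of `f`. -/
theorem integral_sub_integral_le_half {μ ν : Measure S} [IsProbabilityMeasure μ]
    [IsProbabilityMeasure ν] {f : S → ℝ} (hf : Measurable f) {r : ℝ}
    (hr : ∀ x y, f x - f y ≤ r)
    (hTV : ∀ B, MeasurableSet B → μ.real B - ν.real B ≤ 1 / 2) :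
    ∫ x, f x ∂μ - ∫ x, f x ∂ν ≤ r / 2 := by
  obtain ⟨x₀⟩ : Nonempty S := nonempty_of_isProbabilityMeasure μ
  have hr0 : 0 ≤ r := by simpa using hr x₀ x₀
  have hbb : BddBelow (Set.range f) := ⟨f x₀ - r, by rintro _ ⟨x, rfl⟩; linarith [hr x₀ x]⟩
  have : Nonempty S := ⟨x₀⟩
  -- Shifted by its infimum, `f` takes values in `[0, r]`. The layer-cake formula turns its integral
  -- into one of tail probabilities over `(0, r]`, where the total variation bound applies at each
  -- level.
  set a := ⨅ x, f x with ha
  have hg0 : ∀ x, 0 ≤ f x - a := fun x => sub_nonneg.2 (ciInf_le hbb x)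
  have hgr : ∀ x, f x - a ≤ r := fun x => by
    have : f x - r ≤ a := le_ciInf fun y => by linarith [hr x y]
    linarith
  have hgm : Measurable fun x => f x - a := hf.sub_const a
  have hgi : ∀ τ : Measure S, [IsProbabilityMeasure τ] → Integrable (fun x => f x - a) τ :=
    fun τ _ => integrable_of_abs_le hgm (b := r) fun x => by
      rw [abs_of_nonneg (hg0 x)]; exact hgr x
  have hfi : ∀ τ : Measure S, [IsProbabilityMeasure τ] →
      ∫ x, f x ∂τ = a + ∫ t in Set.Ioc 0 r, τ.real {x | t ≤ f x - a} := fun τ _ => by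
    rw [← (hgi τ).integral_eq_integral_Ioc_meas_le (.of_forall hg0) (.of_forall hgr)]
    have : Integrable f τ := by
      simpa [Pi.add_def] using (hgi τ).add (integrable_const a)
    rw [integral_sub this (integrable_const a)]; simp
  have hint : ∀ τ : Measure S, [IsProbabilityMeasure τ] →
      IntegrableOn (fun t => τ.real {x | t ≤ f x - a}) (Set.Ioc 0 r) := fun τ _ => by
    refine integrable_of_abs_le (b := 1) ?_ fun t => ?_
    · exact Antitone.measurable fun s t hst =>
        measureReal_mono fun x hx => le_trans hst hx
    · rw [abs_of_nonneg measureReal_nonneg]; exact measureReal_le_one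
  rw [hfi μ, hfi ν, add_sub_add_left_eq_sub, ← integral_sub (hint μ) (hint ν)]
  calc _ ≤ ∫ t in Set.Ioc 0 r, (1 / 2 : ℝ) := by
        refine integral_mono ((hint μ).sub (hint ν)) (integrable_const _) fun t => ?_
        exact hTV _ (hgm measurableSet_Ici)
    _ = r / 2 := by
      rw [integral_const]; simp [hr0]; ring

variable {K : Kernel S S} [IsMarkovKernel K]

instance isMarkovKernel_pow (k : ℕ) : IsMarkovKernel (K ^ k) := by
  induction k with
  | zero => rw [pow_zero]; exact inferInstanceAs (IsMarkovKernel Kernel.id)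
  | succ k ih => rw [Kernel.pow_add, pow_one]; infer_instance

theorem integral_pow_add {g : S → ℝ} (hg : Measurable g) {b : ℝ} (hb : ∀ x, |g x| ≤ b) (j k : ℕ)
    (s : S) : ∫ x, g x ∂((K ^ (j + k)) s) = ∫ y, ∫ x, g x ∂((K ^ j) y) ∂((K ^ k) s) := by
  rw [Kernel.pow_add, Kernel.integral_comp (integrable_of_abs_le hg hb)]

theorem measurable_integral_kernel {X Y : Type*} [MeasurableSpace X] [MeasurableSpace Y]
    (κ : Kernel X Y) {f : Y → ℝ} (hf : Measurable f) :
    Measurable fun x => ∫ y, f y ∂κ x :=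
  (hf.stronglyMeasurable.integral_kernel (κ := κ)).measurable

/-- Every block of `t` steps halves the oscillation in the starting state: Chapman–Kolmogorov puts
the first `t` steps outside, and the function integrated there has the oscillation bounded at the
previous stage. -/
theorem oscillation_pow_le {t : ℕ}
    (hmix : ∀ s s' B, MeasurableSet B → ((K ^ t) s).real B - ((K ^ t) s').real B ≤ 1 / 2)
    {g : S → ℝ} (hg : Measurable g) {b : ℝ} (hb : ∀ x, |g x| ≤ b) (j k : ℕ) (s s' : S) :
    ∫ x, g x ∂((K ^ (k + j * t)) s) - ∫ x, g x ∂((K ^ (k + j * t)) s') ≤ 2 * b * (1 / 2) ^ j := by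
  induction j generalizing s s' with
  | zero =>
    have h1 := abs_le.1 (abs_integral_le_of_abs_le (μ := (K ^ (k + 0 * t)) s) hb)
    have h2 := abs_le.1 (abs_integral_le_of_abs_le (μ := (K ^ (k + 0 * t)) s') hb)
    simp only [pow_zero]; linarith
  | succ j ih =>
    rw [show k + (j + 1) * t = (k + j * t) + t by ring, integral_pow_add hg hb,
      integral_pow_add hg hb]
    refine (integral_sub_integral_le_half (measurable_integral_kernel _ hg) ih
      (hmix s s')).trans_eq ?_
    ring

theorem integral_integral_of_invariant {ξ : Measure S} [IsProbabilityMeasure ξ]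
    (hinv : Kernel.Invariant K ξ) {g : S → ℝ} (hg : Measurable g) {b : ℝ} (hb : ∀ x, |g x| ≤ b) :
    ∫ s, ∫ x, g x ∂K s ∂ξ = ∫ x, g x ∂ξ := by
  have h : Integrable g ((K ∘ₖ Kernel.const Unit ξ) ()) := integrable_of_abs_le hg hb
  have e := Kernel.integral_comp h
  rw [Kernel.comp_apply, Kernel.const_apply, hinv.def] at e
  exact e.symm

theorem integral_pow_of_invariant {ξ : Measure S} [IsProbabilityMeasure ξ]
    (hinv : Kernel.Invariant K ξ) {g : S → ℝ} (hg : Measurable g) {b : ℝ} (hb : ∀ x, |g x| ≤ b)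
    (k : ℕ) : ∫ s, ∫ x, g x ∂((K ^ k) s) ∂ξ = ∫ x, g x ∂ξ := by
  induction k with
  | zero =>
    simp only [pow_zero]
    change ∫ s, ∫ x, g x ∂(Kernel.id s) ∂ξ = _
    congr with s
    rw [Kernel.id_apply, integral_dirac' _ _ hg.stronglyMeasurable]
  | succ k ih =>
    rw [← ih, ← integral_integral_of_invariant hinv (measurable_integral_kernel (K ^ k) hg)
      (fun x => abs_integral_le_of_abs_le hb)]
    congr with s
    rw [integral_pow_add hg hb, pow_one]

/-- By invariance the stationary mean is the `ξ`-average over starting points `s'` of the same `k +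
j * t` step mean, so the difference is an average of oscillations. -/
theorem abs_integral_pow_sub_le {ξ : Measure S} [IsProbabilityMeasure ξ]
    (hinv : Kernel.Invariant K ξ) {t : ℕ}
    (hmix : ∀ s s' B, MeasurableSet B → ((K ^ t) s).real B - ((K ^ t) s').real B ≤ 1 / 2)
    {g : S → ℝ} (hg : Measurable g) {b : ℝ} (hb : ∀ x, |g x| ≤ b) (j k : ℕ) (s : S) :
    |∫ x, g x ∂((K ^ (k + j * t)) s) - ∫ x, g x ∂ξ| ≤ 2 * b * (1 / 2) ^ j := by
  have hm := measurable_integral_kernel (K ^ (k + j * t)) hg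
  have hi : Integrable (fun s' => ∫ x, g x ∂((K ^ (k + j * t)) s')) ξ :=
    integrable_of_abs_le hm fun x => abs_integral_le_of_abs_le hb
  have e : ∫ x, g x ∂((K ^ (k + j * t)) s) - ∫ x, g x ∂ξ
      = ∫ s', (∫ x, g x ∂((K ^ (k + j * t)) s) - ∫ x, g x ∂((K ^ (k + j * t)) s')) ∂ξ := by
    rw [integral_sub (integrable_const _) hi, integral_pow_of_invariant hinv hg hb]; simp
  rw [e]
  refine abs_integral_le_of_abs_le fun s' => abs_le.2 ⟨?_, ?_⟩
  · linarith [oscillation_pow_le hmix hg hb j k s' s]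
  · exact oscillation_pow_le hmix hg hb j k s s'

/-- An approximate solution of the Poisson equation, with error `O(1 / n)`. -/
theorem exists_approx_poisson {ξ : Measure S} [IsProbabilityMeasure ξ]
    (hinv : Kernel.Invariant K ξ) {t : ℕ}
    (hmix : ∀ s s' B, MeasurableSet B → ((K ^ t) s).real B - ((K ^ t) s').real B ≤ 1 / 2)
    {g : S → ℝ} (hg : Measurable g) {b : ℝ} (hb : ∀ x, |g x| ≤ b) (n : ℕ) :
    ∃ u ρ : S → ℝ, Measurable u ∧ (∀ s, |u s| ≤ 4 * b * t) ∧ (∀ s, n * |ρ s| ≤ 2 * b) ∧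
      ∀ s, g s - ∫ x, g x ∂ξ = u s - ∫ x, u x ∂K s + ρ s := by
  set c := ∫ x, g x ∂ξ with hc
  set q : ℕ → S → ℝ := fun k s => ∫ x, g x ∂((K ^ k) s) - c with hq
  have hqm : ∀ k, Measurable (q k) := fun k => (measurable_integral_kernel (K ^ k) hg).sub_const c
  have hq_le : ∀ j k s, |q (k + j * t) s| ≤ 2 * b * (1 / 2) ^ j := fun j k s =>
    abs_integral_pow_sub_le hinv hmix hg hb j k s
  have hqb : ∀ k s, |q k s| ≤ 2 * b := fun k s => by simpa using hq_le 0 k s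
  have hsucc : ∀ k s, ∫ x, q k x ∂K s = q (k + 1) s := fun k s => by
    have hi : Integrable (fun x => ∫ y, g y ∂((K ^ k) x)) (K s) :=
      integrable_of_abs_le (measurable_integral_kernel (K ^ k) hg)
        fun x => abs_integral_le_of_abs_le hb
    simp only [hq]
    rw [integral_sub hi (integrable_const _), integral_pow_add hg hb, pow_one]; simp
  have hzero : ∀ s, q 0 s = g s - c := fun s => by
    simp only [hq, pow_zero]
    change ∫ x, g x ∂(Kernel.id s) - c = _
    rw [Kernel.id_apply, integral_dirac' _ _ hg.stronglyMeasurable]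
  -- The Neumann series of the Poisson equation, cut after `n` blocks of `t` steps. It telescopes
  -- and leaves the single term `q (n * t)`, of size `2 b / 2 ^ n`.
  refine ⟨fun s => ∑ k ∈ Finset.range (n * t), q k s, q (n * t),
    Finset.measurable_fun_sum _ fun k _ => hqm k, fun s => ?_, fun s => ?_, fun s => ?_⟩
  · have hb0 : 0 ≤ b := (abs_nonneg _).trans (hb s)
    -- Blocks of length `t` contribute at most `2 b t, b t, b t / 2, …`; the geometric sum is kept
    -- with its exact deficit so that the induction closes.
    have key : ∀ n : ℕ, ∑ k ∈ Finset.range (n * t), |q k s| ≤ 4 * b * t * (1 - (1 / 2) ^ n) := by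
      intro n
      induction n with
      | zero => simp
      | succ n ih =>
        rw [add_mul, one_mul, Finset.sum_range_add]
        have : ∑ k ∈ Finset.range t, |q (n * t + k) s| ≤ t * (2 * b * (1 / 2) ^ n) := by
          refine (Finset.sum_le_card_nsmul _ _ (2 * b * (1 / 2) ^ n) fun k _ => ?_).trans_eq ?_
          · rw [add_comm]; exact hq_le n k s
          · simp
        calc _ ≤ 4 * b * t * (1 - (1 / 2) ^ n) + t * (2 * b * (1 / 2) ^ n) := add_le_add ih this
          _ = _ := by rw [pow_succ]; ring
    refine (Finset.abs_sum_le_sum_abs _ _).trans ((key n).trans ?_)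
    refine mul_le_of_le_one_right (by positivity) ?_
    linarith [show (0 : ℝ) ≤ (1 / 2) ^ n by positivity]
  · have hb0 : 0 ≤ b := (abs_nonneg _).trans (hb s)
    have h1 : |q (n * t) s| ≤ 2 * b * (1 / 2) ^ n := by simpa using hq_le n 0 s
    have h2 : (n : ℝ) * (1 / 2) ^ n ≤ 1 := by
      rw [one_div, inv_pow, ← div_eq_mul_inv, div_le_one (by positivity)]
      exact_mod_cast (Nat.lt_two_pow_self).le
    calc (n : ℝ) * |q (n * t) s| ≤ n * (2 * b * (1 / 2) ^ n) := by gcongr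
      _ = 2 * b * (n * (1 / 2) ^ n) := by ring
      _ ≤ 2 * b := mul_le_of_le_one_right (by positivity) h2
  · rw [integral_finsetSum _ fun k _ => integrable_of_abs_le (hqm k) (hqb k)]
    simp only [hsucc]
    rw [← Finset.sum_sub_distrib, Finset.sum_range_sub' (fun k => q k s), hzero]
    ring

end Mixing

/-! ### Averages along a sample path -/

namespace Model

attribute [instance] Model.trans_markov Model.policy_markov Model.xi_prob Model.base_sigmaFinite

variable {S A : Type*} [MeasurableSpace S] [MeasurableSpace A] (M : Model S A)

instance isMarkovKernel_stateKernel (π : Kernel S A) [IsMarkovKernel π] :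
    IsMarkovKernel (M.stateKernel π) := by
  unfold stateKernel; infer_instance

/-- The conditional expectation of `h(s, a, s')` given `s`. -/
noncomputable def step (h : (S × A) × S → ℝ) (s : S) : ℝ :=
  ∫ a, ∫ s', h ((s, a), s') ∂(M.trans (s, a)) ∂(M.policy s)

theorem measurable_inner_step {h : (S × A) × S → ℝ} (hm : Measurable h) :
    Measurable fun x : S × A => ∫ s', h (x, s') ∂(M.trans x) :=
  (hm.stronglyMeasurable.integral_kernel_prod_right' (κ := M.trans)).measurable

theorem measurable_step {h : (S × A) × S → ℝ} (hm : Measurable h) : Measurable (M.step h) :=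
  ((M.measurable_inner_step hm).stronglyMeasurable.integral_kernel_prod_right'
    (κ := M.policy)).measurable

theorem abs_step_le {h : (S × A) × S → ℝ} {b : ℝ} (hb : ∀ y, |h y| ≤ b) (s : S) :
    |M.step h s| ≤ b :=
  abs_integral_le_of_abs_le fun _ => abs_integral_le_of_abs_le fun _ => hb _

theorem step_mono {h h' : (S × A) × S → ℝ} (hm : Measurable h) (hm' : Measurable h') {b b' : ℝ}
    (hb : ∀ y, |h y| ≤ b) (hb' : ∀ y, |h' y| ≤ b') (hle : ∀ y, h y ≤ h' y) (s : S) :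
    M.step h s ≤ M.step h' s := by
  refine integral_mono ?_ ?_ fun a => integral_mono ?_ ?_ fun s' => hle _
  · exact integrable_of_abs_le ((M.measurable_inner_step hm).comp measurable_prodMk_left)
      fun _ => abs_integral_le_of_abs_le fun _ => hb _
  · exact integrable_of_abs_le ((M.measurable_inner_step hm').comp measurable_prodMk_left)
      fun _ => abs_integral_le_of_abs_le fun _ => hb' _
  · exact integrable_of_abs_le (hm.comp measurable_prodMk_left) fun _ => hb _
  · exact integrable_of_abs_le (hm'.comp measurable_prodMk_left) fun _ => hb' _

theorem step_add {h h' : (S × A) × S → ℝ} (hm : Measurable h) (hm' : Measurable h') {b b' : ℝ}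
    (hb : ∀ y, |h y| ≤ b) (hb' : ∀ y, |h' y| ≤ b') (s : S) :
    M.step (fun y => h y + h' y) s = M.step h s + M.step h' s := by
  unfold step
  rw [← integral_add]
  · refine integral_congr_ae (.of_forall fun a => integral_add ?_ ?_)
    · exact integrable_of_abs_le (hm.comp measurable_prodMk_left) fun _ => hb _
    · exact integrable_of_abs_le (hm'.comp measurable_prodMk_left) fun _ => hb' _
  · exact integrable_of_abs_le ((M.measurable_inner_step hm).comp measurable_prodMk_left)
      fun _ => abs_integral_le_of_abs_le fun _ => hb _
  · exact integrable_of_abs_le ((M.measurable_inner_step hm').comp measurable_prodMk_left)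
      fun _ => abs_integral_le_of_abs_le fun _ => hb' _

/-- Lets the Poisson correction be read as a conditional mean of a function of the transition, so
that it can be merged into a martingale difference. -/
theorem integral_stateKernel {u : S → ℝ} (hu : Measurable u) {b : ℝ} (hb : ∀ s, |u s| ≤ b) (s : S) :
    ∫ x, u x ∂(M.stateKernel M.policy s) = M.step (fun y => u y.2) s := by
  have hm : Measurable fun x : S × A => ∫ y, u y ∂M.trans x :=
    M.measurable_inner_step (hu.comp measurable_snd)
  unfold stateKernel step
  rw [Kernel.integral_comp (integrable_of_abs_le hu hb), Kernel.prod_apply, Kernel.id_apply,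
    Measure.dirac_prod, integral_map (by fun_prop) hm.aestronglyMeasurable]

variable {M} {Ω : Type*} [MeasurableSpace Ω] {Pr : Measure Ω}
  {X : ℕ → Ω → S} {U : ℕ → Ω → A}

theorem IsSamplePath.measurable_history (hp : M.IsSamplePath Pr X U) (k : ℕ) :
    Measurable (history X U k) := by
  refine Measurable.prodMk (f := fun ω (i : Fin k) => (X i ω, U i ω)) ?_ (hp.1 k)
  exact measurable_pi_lambda _ fun i => (hp.1 i).prodMk (hp.2.1 i)

variable [IsProbabilityMeasure Pr]

/-- The tower property, tested against bounded functions of the history: first the law of the next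
state given history and action is integrated out, then the law of the action given the history. -/
theorem IsSamplePath.integral_mul (hp : M.IsSamplePath Pr X U) (k : ℕ)
    {W : (Fin k → S × A) × S → ℝ} (hW : Measurable W) {w : ℝ} (hw : ∀ y, |W y| ≤ w)
    {h : (S × A) × S → ℝ} (hm : Measurable h) {b : ℝ} (hb : ∀ y, |h y| ≤ b) :
    ∫ ω, W (history X U k ω) * h ((X k ω, U k ω), X (k + 1) ω) ∂Pr =
      ∫ ω, W (history X U k ω) * M.step h (X k ω) ∂Pr := by
  have hH := hp.measurable_history k
  have hU := hp.2.1 k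
  have hX := hp.1 (k + 1)
  have : IsProbabilityMeasure (Pr.map (history X U k)) :=
    Measure.isProbabilityMeasure_map hH.aemeasurable
  have : IsProbabilityMeasure (Pr.map fun ω => (history X U k ω, U k ω)) :=
    Measure.isProbabilityMeasure_map (hH.prodMk hU).aemeasurable
  have hw0 : ∀ y z, |W y * h z| ≤ w * b := fun y z => by
    rw [abs_mul]; exact mul_le_mul (hw y) (hb z) (abs_nonneg _) ((abs_nonneg _).trans (hw y))
  have hfm : Measurable fun y : (((Fin k → S × A) × S) × A) × S =>
      W y.1.1 * h ((y.1.1.2, y.1.2), y.2) := by fun_prop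
  have hgm : Measurable fun y : ((Fin k → S × A) × S) × A =>
      W y.1 * ∫ s', h ((y.1.2, y.2), s') ∂M.trans (y.1.2, y.2) := by
    have := M.measurable_inner_step hm
    have h2 : Measurable fun y : ((Fin k → S × A) × S) × A =>
      ∫ s', h ((y.1.2, y.2), s') ∂M.trans (y.1.2, y.2) :=
      this.comp (g := fun x : S × A => ∫ s', h (x, s') ∂M.trans x)
        (f := fun y : ((Fin k → S × A) × S) × A => (y.1.2, y.2)) (by fun_prop)
    exact (hW.comp measurable_fst).mul h2
  have hgb : ∀ y : ((Fin k → S × A) × S) × A,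
      |W y.1 * ∫ s', h ((y.1.2, y.2), s') ∂M.trans (y.1.2, y.2)| ≤ w * b := fun y => by
    rw [abs_mul]
    exact mul_le_mul (hw _) (abs_integral_le_of_abs_le fun _ => hb _) (abs_nonneg _)
      ((abs_nonneg _).trans (hw y.1))
  calc _ = ∫ y, W y.1.1 * h ((y.1.1.2, y.1.2), y.2)
        ∂(Pr.map fun ω => ((history X U k ω, U k ω), X (k + 1) ω)) := by
        rw [integral_map ((hH.prodMk hU).prodMk hX).aemeasurable hfm.aestronglyMeasurable]
        rfl
    _ = ∫ y, W y.1 * ∫ s', h ((y.1.2, y.2), s') ∂M.trans (y.1.2, y.2)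
        ∂(Pr.map fun ω => (history X U k ω, U k ω)) := by
        rw [hp.2.2.2 k, Measure.integral_compProd (integrable_of_abs_le hfm fun _ => hw0 _ _)]
        refine integral_congr_ae (.of_forall fun y => ?_)
        exact integral_const_mul (μ := M.trans (y.1.2, y.2)) (W y.1)
          (fun s' => h ((y.1.2, y.2), s'))
    _ = ∫ y, W y * M.step h y.2 ∂(Pr.map (history X U k)) := by
        rw [hp.2.2.1 k, Measure.integral_compProd (integrable_of_abs_le hgm hgb)]
        refine integral_congr_ae (.of_forall fun y => ?_)
        exact integral_const_mul (μ := M.policy y.2) (W y)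
          (fun a => ∫ s', h ((y.2, a), s') ∂M.trans (y.2, a))
    _ = _ := by
        have hs := M.measurable_step hm
        have : Measurable fun y : (Fin k → S × A) × S => W y * M.step h y.2 :=
          hW.mul (hs.comp measurable_snd)
        rw [integral_map hH.aemeasurable this.aestronglyMeasurable]
        rfl

theorem IsSamplePath.integral_step (hp : M.IsSamplePath Pr X U) (k : ℕ)
    {h : (S × A) × S → ℝ} (hm : Measurable h) {b : ℝ} (hb : ∀ y, |h y| ≤ b) :
    ∫ ω, h ((X k ω, U k ω), X (k + 1) ω) ∂Pr = ∫ ω, M.step h (X k ω) ∂Pr := by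
  simpa using hp.integral_mul k (W := fun _ => 1) measurable_const (w := 1) (by simp) hm hb

/-- The fluctuation `∑ (h(X_i, U_i, X_{i+1}) - 𝔼[h | X_i])` is a martingale, so its variance is the
sum of the conditional variances. -/
theorem IsSamplePath.integral_martingale_sq_le (hp : M.IsSamplePath Pr X U)
    {h : (S × A) × S → ℝ} (hm : Measurable h) {b : ℝ} (hb : ∀ y, |h y| ≤ b) {v : ℝ}
    (hv : ∀ s, M.step (fun y => h y ^ 2) s ≤ v) (n : ℕ) :
    ∫ ω, (∑ i ∈ Finset.range n, (h ((X i ω, U i ω), X (i + 1) ω) - M.step h (X i ω))) ^ 2 ∂Pr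
      ≤ n * v := by
  set D : ℕ → Ω → ℝ := fun i ω => h ((X i ω, U i ω), X (i + 1) ω) - M.step h (X i ω) with hD
  have hsm := M.measurable_step hm
  have hXU : ∀ i, Measurable fun ω => ((X i ω, U i ω), X (i + 1) ω) := fun i =>
    ((hp.1 i).prodMk (hp.2.1 i)).prodMk (hp.1 (i + 1))
  have hDm : ∀ i, Measurable (D i) := fun i =>
    (hm.comp (hXU i)).sub (hsm.comp (hp.1 i))
  have hDb : ∀ i ω, |D i ω| ≤ b + b := fun i ω =>
    (abs_sub _ _).trans (add_le_add (hb _) (M.abs_step_le hb _))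
  have hSm : ∀ n, Measurable fun ω => ∑ i ∈ Finset.range n, D i ω := fun n =>
    Finset.measurable_fun_sum _ fun i _ => hDm i
  have hSb : ∀ n ω, |∑ i ∈ Finset.range n, D i ω| ≤ n * (b + b) := fun n ω =>
    (Finset.abs_sum_le_sum_abs _ _).trans
      ((Finset.sum_le_card_nsmul _ _ (b + b) fun i _ => hDb i ω).trans_eq (by simp; ring))
  have hint : ∀ {f g : Ω → ℝ} {a c : ℝ}, Measurable f → Measurable g → (∀ ω, |f ω| ≤ a) →
      (∀ ω, |g ω| ≤ c) → Integrable (fun ω => f ω * g ω) Pr := fun hf hg ha hc =>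
    integrable_of_abs_le (hf.mul hg) fun ω => by
      rw [abs_mul]
      exact mul_le_mul (ha ω) (hc ω) (abs_nonneg _) ((abs_nonneg _).trans (ha ω))
  induction n with
  | zero => simp
  | succ n ih =>
    have cross : ∫ ω, (∑ i ∈ Finset.range n, D i ω) * D n ω ∂Pr = 0 := by
      -- The past sum as a function of the history. The successor state of step `i` is stored with
      -- the pair `i + 1`, except for the last step, whose successor is the final state of the
      -- history.
      set W : (Fin n → S × A) × S → ℝ := fun H =>
        ∑ i : Fin n, (h (H.1 i, if hi : i.1 + 1 < n then (H.1 ⟨i.1 + 1, hi⟩).1 else H.2)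
          - M.step h (H.1 i).1) with hWdef
      have hWm : Measurable W := by
        refine Finset.measurable_fun_sum _ fun i _ => ?_
        have h1 : Measurable fun H : (Fin n → S × A) × S => H.1 i :=
          (measurable_pi_apply i).comp measurable_fst
        refine (hm.comp (h1.prodMk ?_)).sub (hsm.comp (measurable_fst.comp h1))
        split_ifs with hi
        · exact measurable_fst.comp ((measurable_pi_apply _).comp measurable_fst)
        · exact measurable_snd
      have hWb : ∀ H, |W H| ≤ n * (b + b) := fun H =>
        (Finset.abs_sum_le_sum_abs _ _).trans
          ((Finset.sum_le_card_nsmul _ _ (b + b) fun i _ =>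
            (abs_sub _ _).trans (add_le_add (hb _) (M.abs_step_le hb _))).trans_eq (by simp; ring))
      have hWe : ∀ ω, ∑ i ∈ Finset.range n, D i ω = W (history X U n ω) := fun ω => by
        rw [Finset.sum_range]
        refine Finset.sum_congr rfl fun i _ => ?_
        simp only [hD, history]
        split_ifs with hi
        · rfl
        · rw [show i.1 + 1 = n by omega]
      have hWhm : Measurable fun ω => W (history X U n ω) := hWm.comp (hp.measurable_history n)
      have iA : Integrable (fun ω => W (history X U n ω) * h ((X n ω, U n ω), X (n + 1) ω)) Pr :=
        hint hWhm (hm.comp (hXU n)) (fun _ => hWb _) fun _ => hb _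
      have iB : Integrable (fun ω => W (history X U n ω) * M.step h (X n ω)) Pr :=
        hint hWhm (hsm.comp (hp.1 n)) (fun _ => hWb _) fun _ => M.abs_step_le hb _
      have e : ∀ ω, (∑ i ∈ Finset.range n, D i ω) * D n ω =
          W (history X U n ω) * h ((X n ω, U n ω), X (n + 1) ω) -
          W (history X U n ω) * M.step h (X n ω) := fun ω => by rw [hWe, ← mul_sub]
      rw [integral_congr_ae (.of_forall e), integral_sub iA iB,
        hp.integral_mul n hWm hWb hm hb, sub_self]
    have hsq : ∀ y, |h y ^ 2| ≤ b ^ 2 := fun y => by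
      rw [abs_pow]; exact pow_le_pow_left₀ (abs_nonneg _) (hb y) 2
    -- A conditional variance is the conditional second moment minus a square; the square is
    -- dropped.
    have diag : ∫ ω, D n ω * D n ω ∂Pr ≤ v := by
      have e1 := hp.integral_mul n (W := fun H => M.step h H.2) (hsm.comp measurable_snd)
        (fun y => M.abs_step_le hb _) hm hb
      have e2 := hp.integral_step n (h := fun y => h y ^ 2) (by fun_prop) hsq
      simp only [history] at e1
      have i1 : Integrable (fun ω => h ((X n ω, U n ω), X (n + 1) ω) ^ 2) Pr :=
        integrable_of_abs_le ((hm.comp (hXU n)).pow_const 2) fun _ => hsq _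
      have i2 := hint (hsm.comp (hp.1 n)) (hm.comp (hXU n)) (fun _ => M.abs_step_le hb _)
        fun _ => hb _
      have i3 := hint (hsm.comp (hp.1 n)) (hsm.comp (hp.1 n)) (fun _ => M.abs_step_le hb _)
        fun _ => M.abs_step_le hb _
      simp only [Function.comp_apply] at i2 i3
      have : ∀ ω, D n ω * D n ω = h ((X n ω, U n ω), X (n + 1) ω) ^ 2 -
          2 * (M.step h (X n ω) * h ((X n ω, U n ω), X (n + 1) ω)) +
          M.step h (X n ω) * M.step h (X n ω) := fun ω => by simp only [hD]; ring
      have i4 : Integrable (fun ω => h ((X n ω, U n ω), X (n + 1) ω) ^ 2 -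
          2 * (M.step h (X n ω) * h ((X n ω, U n ω), X (n + 1) ω))) Pr := i1.sub (i2.const_mul 2)
      rw [integral_congr_ae (.of_forall this), integral_add i4 i3, integral_sub i1 (i2.const_mul 2),
        integral_const_mul, e1, e2]
      have hle : ∫ ω, M.step (fun y => h y ^ 2) (X n ω) ∂Pr ≤ v := by
        refine (integral_mono (g := fun _ => v) (integrable_of_abs_le
          ((M.measurable_step (by fun_prop)).comp (hp.1 n)) fun _ => M.abs_step_le hsq _)
          (integrable_const _) fun ω => hv _).trans_eq (by simp)
      have hnn : 0 ≤ ∫ ω, M.step h (X n ω) * M.step h (X n ω) ∂Pr :=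
        integral_nonneg fun ω => mul_self_nonneg _
      linarith
    have : ∀ ω, (∑ i ∈ Finset.range (n + 1), D i ω) ^ 2 =
        (∑ i ∈ Finset.range n, D i ω) * (∑ i ∈ Finset.range n, D i ω) +
        2 * ((∑ i ∈ Finset.range n, D i ω) * D n ω) + D n ω * D n ω := fun ω => by
      rw [Finset.sum_range_succ]; ring
    have j1 := hint (hSm n) (hSm n) (hSb n) (hSb n)
    have j2 := (hint (hSm n) (hDm n) (hSb n) (hDb n)).const_mul 2
    have j3 := hint (hDm n) (hDm n) (hDb n) (hDb n)
    have j4 : Integrable (fun ω => (∑ i ∈ Finset.range n, D i ω) * (∑ i ∈ Finset.range n, D i ω) +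
        2 * ((∑ i ∈ Finset.range n, D i ω) * D n ω)) Pr := j1.add j2
    rw [integral_congr_ae (.of_forall fun ω => sq _)] at ih
    rw [integral_congr_ae (.of_forall this), integral_add j4 j3, integral_add j1 j2, integral_const_mul, cross]
    push_cast
    linarith

/-- Triangle inequality through the invariant law supplied by mixing, which need not be identified
with `ξ` because only two starting states are compared. -/
theorem MixesBy.sub_le_half {t : ℕ} (ht : M.MixesBy t) (s s' : S) (B : Set S)
    (hB : MeasurableSet B) :
    ((M.stateKernel M.policy ^ t) s).real B - ((M.stateKernel M.policy ^ t) s').real B ≤ 1 / 2 := by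
  obtain ⟨ν, _, _, h⟩ := ht M.policy inferInstance
  have h1 := abs_le.1 (h s t le_rfl B hB)
  have h2 := abs_le.1 (h s' t le_rfl B hB)
  linarith

theorem HasFiniteMixingTime.one_le_tmix (h : M.HasFiniteMixingTime) : 1 ≤ M.tmix :=
  (Nat.sInf_mem h).1

theorem HasFiniteMixingTime.mixesBy_tmix (h : M.HasFiniteMixingTime) : M.MixesBy M.tmix :=
  (Nat.sInf_mem h).2

/-- Averages along a sample path concentrate around the stationary mean in mean square, at a rate
governed by the conditional second moment and the mixing time. -/
theorem IsSamplePath.integral_average_sq_le (hp : M.IsSamplePath Pr X U)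
    (hmix : M.HasFiniteMixingTime) {h : (S × A) × S → ℝ} (hm : Measurable h) {b : ℝ}
    (hb : ∀ y, |h y| ≤ b) {v : ℝ} (hv : ∀ s, M.step (fun y => h y ^ 2) s ≤ v) {c : ℝ}
    (hc : ∀ s, |M.step h s| ≤ c) {n : ℕ} (hn : 1 ≤ n) :
    ∫ ω, ((n : ℝ)⁻¹ * ∑ i ∈ Finset.range n, h ((X i ω, U i ω), X (i + 1) ω)
      - ∫ s, M.step h s ∂M.xi) ^ 2 ∂Pr ≤ (4 * v + 300 * c ^ 2 * M.tmix ^ 2) / n := by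
  set t := M.tmix with ht
  have ht1 : (1 : ℝ) ≤ t := by exact_mod_cast hmix.one_le_tmix
  obtain ⟨s₀⟩ : Nonempty S := nonempty_of_isProbabilityMeasure M.xi
  have hc0 : 0 ≤ c := (abs_nonneg _).trans (hc s₀)
  have hn1 : (1 : ℝ) ≤ n := by exact_mod_cast hn
  have hsm := M.measurable_step hm
  obtain ⟨u, ρ, hum, hub, hρ, hu⟩ := exists_approx_poisson (K := M.stateKernel M.policy)
    (ξ := M.xi) M.xi_invariant hmix.mixesBy_tmix.sub_le_half hsm hc n
  set μ := ∫ s, M.step h s ∂M.xi with hμ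
  -- With the Poisson correction at the next state added, `h - μ = (H - step H) + (u(s) - u(s')) +
  -- ρ(s)`: a martingale difference, a telescoping term and a negligible error.
  set H : (S × A) × S → ℝ := fun y => h y + u y.2 with hH
  have hu2 : Measurable fun y : (S × A) × S => u y.2 := hum.comp measurable_snd
  have hHm : Measurable H := hm.add hu2
  have hHb : ∀ y, |H y| ≤ b + 4 * c * t := fun y =>
    (abs_add_le _ _).trans (add_le_add (hb _) (hub _))
  have hHs : ∀ s, M.step H s = M.step h s + ∫ x, u x ∂(M.stateKernel M.policy s) := fun s => by
    rw [M.integral_stateKernel hum hub]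
    exact M.step_add hm hu2 hb (fun y => hub _) s
  have hsqb : ∀ y, |h y ^ 2| ≤ b ^ 2 := fun y => by
    rw [abs_pow]; exact pow_le_pow_left₀ (abs_nonneg _) (hb y) 2
  have hHv : ∀ s, M.step (fun y => H y ^ 2) s ≤ 2 * v + 2 * (4 * c * t) ^ 2 := fun s => by
    have h2 : ∀ y, H y ^ 2 ≤ (h y ^ 2 + h y ^ 2) + 2 * (4 * c * t) ^ 2 := fun y => by
      have : u y.2 ^ 2 ≤ (4 * c * t) ^ 2 := sq_le_sq' (by linarith [(abs_le.1 (hub y.2)).1])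
        (abs_le.1 (hub y.2)).2
      have h3 : H y = h y + u y.2 := rfl
      rw [h3]; nlinarith [sq_nonneg (h y - u y.2)]
    have hb2 : ∀ y, |h y ^ 2 + h y ^ 2| ≤ b ^ 2 + b ^ 2 := fun y =>
      (abs_add_le _ _).trans (add_le_add (hsqb y) (hsqb y))
    have hm2 : Measurable fun y => h y ^ 2 := hm.pow_const 2
    refine (M.step_mono (hHm.pow_const 2) ((hm2.add hm2).add_const _)
      (b := (b + 4 * c * t) ^ 2) (b' := b ^ 2 + b ^ 2 + 2 * (4 * c * t) ^ 2) (fun y => ?_)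
      (fun y => ?_) h2 s).trans ?_
    · rw [abs_pow]; exact pow_le_pow_left₀ (abs_nonneg _) (hHb y) 2
    · refine (abs_add_le _ _).trans (add_le_add (hb2 y) (abs_of_nonneg (by positivity)).le)
    · have e1 := M.step_add (hm2.add hm2) (measurable_const (a := 2 * (4 * c * t) ^ 2)) hb2
        (fun _ => le_rfl) s
      have e2 := M.step_add hm2 hm2 hsqb hsqb s
      have e3 : M.step (fun _ => 2 * (4 * c * t) ^ 2) s = 2 * (4 * c * t) ^ 2 := by
        simp [step]
      have := hv s
      refine e1.trans_le ?_
      refine (add_le_add (e2.le.trans (add_le_add this this)) e3.le).trans_eq (by ring)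
  have hmart := hp.integral_martingale_sq_le hHm hHb hHv n
  set Mn : Ω → ℝ := fun ω => ∑ i ∈ Finset.range n,
    (H ((X i ω, U i ω), X (i + 1) ω) - M.step H (X i ω)) with hMn
  have hMm : Measurable Mn := Finset.measurable_fun_sum _ fun i _ =>
    (hHm.comp (((hp.1 i).prodMk (hp.2.1 i)).prodMk (hp.1 (i + 1)))).sub
      ((M.measurable_step hHm).comp (hp.1 i))
  have hMb : ∀ ω, |Mn ω| ≤ n * ((b + 4 * c * t) + (b + 4 * c * t)) := fun ω =>
    (Finset.abs_sum_le_sum_abs _ _).trans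
      ((Finset.sum_le_card_nsmul _ _ ((b + 4 * c * t) + (b + 4 * c * t)) fun i _ =>
        (abs_sub _ _).trans (add_le_add (hHb _) (M.abs_step_le hHb _))).trans_eq (by simp; ring))
  have decomp : ∀ ω, ∑ i ∈ Finset.range n, h ((X i ω, U i ω), X (i + 1) ω) - n * μ =
      Mn ω + (u (X 0 ω) - u (X n ω) + ∑ i ∈ Finset.range n, ρ (X i ω)) := fun ω => by
    have e : ∀ i, h ((X i ω, U i ω), X (i + 1) ω) - μ =
        (H ((X i ω, U i ω), X (i + 1) ω) - M.step H (X i ω)) +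
        ((u (X i ω) - u (X (i + 1) ω)) + ρ (X i ω)) := fun i => by
      have := hu (X i ω)
      rw [hHs]; simp only [hH]; linarith
    rw [show (n : ℝ) * μ = ∑ i ∈ Finset.range n, μ by simp, ← Finset.sum_sub_distrib,
      Finset.sum_congr rfl fun i _ => e i, Finset.sum_add_distrib, Finset.sum_add_distrib,
      Finset.sum_range_sub' (fun i => u (X i ω))]
  -- The two boundary values of `u` give `8 c t`, the errors `ρ` give `2 c` in total, and `1 ≤ t`.
  have hrem : ∀ ω, |u (X 0 ω) - u (X n ω) + ∑ i ∈ Finset.range n, ρ (X i ω)| ≤ 10 * c * t :=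
    fun ω => by
      have h1 : |∑ i ∈ Finset.range n, ρ (X i ω)| ≤ 2 * c := by
        refine (Finset.abs_sum_le_sum_abs _ _).trans
          ((Finset.sum_le_card_nsmul _ _ (2 * c / n) fun i _ => ?_).trans_eq ?_)
        · rw [le_div_iff₀ (by linarith), mul_comm]; exact hρ _
        · rw [Finset.card_range, nsmul_eq_mul]; field_simp
      have h2 := abs_sub (u (X 0 ω)) (u (X n ω))
      have h3 := hub (X 0 ω)
      have h4 := hub (X n ω)
      have h5 := abs_add_le (u (X 0 ω) - u (X n ω)) (∑ i ∈ Finset.range n, ρ (X i ω))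
      nlinarith
  have hpt : ∀ ω, ((n : ℝ)⁻¹ * ∑ i ∈ Finset.range n, h ((X i ω, U i ω), X (i + 1) ω) - μ) ^ 2 ≤
      ((n : ℝ) ^ 2)⁻¹ * (2 * Mn ω ^ 2 + 2 * (10 * c * t) ^ 2) := fun ω => by
    have e : (n : ℝ)⁻¹ * ∑ i ∈ Finset.range n, h ((X i ω, U i ω), X (i + 1) ω) - μ =
        (n : ℝ)⁻¹ * (Mn ω + (u (X 0 ω) - u (X n ω) + ∑ i ∈ Finset.range n, ρ (X i ω))) := by
      rw [← decomp]; field_simp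
    rw [e, mul_pow, inv_pow]
    refine mul_le_mul_of_nonneg_left ?_ (by positivity)
    have h1 := hrem ω
    set R := u (X 0 ω) - u (X n ω) + ∑ i ∈ Finset.range n, ρ (X i ω)
    have : R ^ 2 ≤ (10 * c * t) ^ 2 := sq_le_sq' (by linarith [(abs_le.1 h1).1]) (abs_le.1 h1).2
    nlinarith [sq_nonneg (Mn ω - R)]
  have hMi : Integrable (fun ω => Mn ω ^ 2) Pr := integrable_of_abs_le (hMm.pow_const 2)
    (b := (n * ((b + 4 * c * t) + (b + 4 * c * t))) ^ 2) fun ω => by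
      rw [abs_pow]; exact pow_le_pow_left₀ (abs_nonneg _) (hMb ω) 2
  have hi2 : Integrable (fun ω => ((n : ℝ) ^ 2)⁻¹ * (2 * Mn ω ^ 2 + 2 * (10 * c * t) ^ 2)) Pr :=
    ((hMi.const_mul 2).add (integrable_const _)).const_mul _
  refine (integral_mono_of_nonneg (.of_forall fun ω => sq_nonneg _) hi2 (.of_forall hpt)).trans ?_
  rw [integral_const_mul, integral_add (hMi.const_mul 2) (integrable_const _), integral_const_mul]
  simp only [integral_const, probReal_univ, smul_eq_mul, one_mul]
  rw [le_div_iff₀ (by linarith), mul_comm, ← mul_assoc,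
    show (n : ℝ) * ((n : ℝ) ^ 2)⁻¹ = (n : ℝ)⁻¹ by field_simp, inv_mul_le_iff₀ (by linarith)]
  -- The numerator is `2 n (2 v + 32 c² t²) + 200 c² t²`, at most `n (4 v + 264 c² t²)`; `300` is a
  -- round upper bound.
  have h6 : 0 ≤ (c * t) ^ 2 := sq_nonneg _
  have h7 : (c * t) ^ 2 ≤ n * (c * t) ^ 2 := by nlinarith
  have h8 : (n : ℝ) * (4 * v + 300 * c ^ 2 * t ^ 2) = n * (4 * v) + 300 * (n * (c * t) ^ 2) := by
    ring
  have h9 : (n : ℝ) * (2 * v + 2 * (4 * c * t) ^ 2) = n * (2 * v) + 32 * (n * (c * t) ^ 2) := by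
    ring
  rw [h8]; rw [h9] at hmart
  nlinarith

end Model

/-! ### Tensor and matrix bounds -/

section TensorBounds

variable {p q k p' q' k' : ℕ}

theorem abs_apply_le_norm {d : ℕ} (x : EuclideanSpace ℝ (Fin d)) (i : Fin d) : |x i| ≤ ‖x‖ := by
  simpa using PiLp.norm_apply_le x i

theorem abs_outer3_le {u : EuclideanSpace ℝ (Fin p)} {v : EuclideanSpace ℝ (Fin q)}
    {w : EuclideanSpace ℝ (Fin k)} (hu : ‖u‖ = 1) (hv : ‖v‖ = 1) (hw : ‖w‖ = 1)
    (i : Fin p) (j : Fin q) (c : Fin k) : |outer3 u v w i j c| ≤ 1 := by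
  have h1 := hu ▸ abs_apply_le_norm u i
  have h2 := hv ▸ abs_apply_le_norm v j
  have h3 := hw ▸ abs_apply_le_norm w c
  simp only [outer3, abs_mul]
  exact mul_le_one₀ (mul_le_one₀ h1 (abs_nonneg _) h2) (abs_nonneg _) h3

theorem sum_mul_outer3_le {X : Tensor3 p q k} {ε : ℝ} (hX : ∀ i j c, |X i j c| ≤ ε)
    {u : EuclideanSpace ℝ (Fin p)} {v : EuclideanSpace ℝ (Fin q)} {w : EuclideanSpace ℝ (Fin k)}
    (hu : ‖u‖ = 1) (hv : ‖v‖ = 1) (hw : ‖w‖ = 1) :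
    ∑ i, ∑ j, ∑ c, X i j c * outer3 u v w i j c ≤ p * q * k * ε := by
  calc _ ≤ ∑ _i : Fin p, ∑ _j : Fin q, ∑ _c : Fin k, ε := by
        refine Finset.sum_le_sum fun i _ => Finset.sum_le_sum fun j _ =>
          Finset.sum_le_sum fun c _ => (le_abs_self _).trans ?_
        rw [abs_mul]
        exact (mul_le_mul (hX i j c) (abs_outer3_le hu hv hw i j c) (abs_nonneg _)
          ((abs_nonneg _).trans (hX i j c))).trans_eq (mul_one ε)
    _ = _ := by simp; ring

/-- With `abs_entry_le_tensorNorm` this allows working entrywise throughout, at the price of a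
dimension factor that the threshold absorbs. -/
theorem tensorNorm_le {X : Tensor3 p q k} {ε : ℝ} (hε : 0 ≤ ε) (hX : ∀ i j c, |X i j c| ≤ ε) :
    tensorNorm X ≤ p * q * k * ε := by
  refine Real.sSup_le ?_ (by positivity)
  rintro _ ⟨u, v, w, hu, hv, hw, rfl⟩
  exact sum_mul_outer3_le hX hu hv hw

theorem bddAbove_tensorNorm_set (X : Tensor3 p q k) :
    BddAbove {x : ℝ | ∃ (u : EuclideanSpace ℝ (Fin p)) (v : EuclideanSpace ℝ (Fin q))
      (w : EuclideanSpace ℝ (Fin k)), ‖u‖ = 1 ∧ ‖v‖ = 1 ∧ ‖w‖ = 1 ∧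
      x = ∑ i, ∑ j, ∑ c, X i j c * outer3 u v w i j c} := by
  refine ⟨p * q * k * ∑ i, ∑ j, ∑ c, |X i j c|, ?_⟩
  rintro _ ⟨u, v, w, hu, hv, hw, rfl⟩
  refine sum_mul_outer3_le (fun i j c => ?_) hu hv hw
  refine le_trans ?_ (Finset.single_le_sum (f := fun i => ∑ j, ∑ c, |X i j c|)
    (fun _ _ => by positivity) (Finset.mem_univ i))
  refine le_trans ?_ (Finset.single_le_sum (f := fun j => ∑ c, |X i j c|)
    (fun _ _ => by positivity) (Finset.mem_univ j))
  exact Finset.single_le_sum (f := fun c => |X i j c|) (fun _ _ => abs_nonneg _)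
    (Finset.mem_univ c)

/-- Test against coordinate vectors, with one of them negated to reach the opposite sign. -/
theorem abs_entry_le_tensorNorm (X : Tensor3 p q k) (i : Fin p) (j : Fin q) (c : Fin k) :
    |X i j c| ≤ tensorNorm X := by
  have hs : ∀ (i' : Fin p) (j' : Fin q) (c' : Fin k),
      outer3 (EuclideanSpace.single i (1 : ℝ)) (EuclideanSpace.single j (1 : ℝ))
        (EuclideanSpace.single c (1 : ℝ)) i' j' c' =
      if i' = i then if j' = j then if c' = c then 1 else 0 else 0 else 0 := by
    intro i' j' c'
    simp only [outer3, PiLp.single_apply]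
    split_ifs <;> simp
  have hs' : ∀ (i' : Fin p) (j' : Fin q) (c' : Fin k),
      outer3 (-EuclideanSpace.single i (1 : ℝ) : EuclideanSpace ℝ (Fin p))
        (EuclideanSpace.single j (1 : ℝ)) (EuclideanSpace.single c (1 : ℝ)) i' j' c' =
      if i' = i then if j' = j then if c' = c then -1 else 0 else 0 else 0 := by
    intro i' j' c'
    simp only [outer3, PiLp.neg_apply, PiLp.single_apply]
    split_ifs <;> simp
  refine abs_le'.2 ⟨le_csSup (bddAbove_tensorNorm_set X) ?_,
    le_csSup (bddAbove_tensorNorm_set X) ?_⟩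
  · refine ⟨EuclideanSpace.single i 1, EuclideanSpace.single j 1, EuclideanSpace.single c 1,
      by simp, by simp, by simp, ?_⟩
    simp only [hs]; simp
  · refine ⟨-EuclideanSpace.single i 1, EuclideanSpace.single j 1, EuclideanSpace.single c 1,
      by simp, by simp, by simp, ?_⟩
    simp only [hs']; simp

/-- A best low-rank approximation of a perturbation of a low-rank tensor `F` is close to `F`. -/
theorem IsLowRankApprox.abs_sub_le {X Q F : Tensor3 p q k} {r l m : ℕ} {ε : ℝ}
    (hQ : IsLowRankApprox X r l m Q) (hF : TuckerRankLE F r l m)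
    (hX : ∀ i j c, |X i j c - F i j c| ≤ ε) (i : Fin p) (j : Fin q) (c : Fin k) :
    |Q i j c - F i j c| ≤ (p * q * k + 1) * ε := by
  -- `F` is itself a competitor in the minimization, so `Q` is no farther from `X` than `F` is.
  have h1 : |Q i j c - X i j c| ≤ p * q * k * ε :=
    (abs_entry_le_tensorNorm (Q - X) i j c).trans <| (hQ.2 F hF).trans <|
      tensorNorm_le ((abs_nonneg _).trans (hX i j c)) fun i j c => by
        rw [Pi.sub_apply, Pi.sub_apply, Pi.sub_apply, abs_sub_comm]; exact hX i j c
  have h2 := abs_add_le (Q i j c - X i j c) (X i j c - F i j c)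
  rw [sub_add_sub_cancel] at h2
  linarith [hX i j c]

theorem mode1_mode1 (X : Tensor3 p q k) {p'' : ℕ} (U : Matrix (Fin p') (Fin p) ℝ)
    (V : Matrix (Fin p'') (Fin p') ℝ) : mode1 (mode1 X U) V = mode1 X (V * U) := by
  funext a j c
  simp only [mode1, Matrix.mul_apply, Finset.mul_sum, Finset.sum_mul]
  rw [Finset.sum_comm]
  exact Finset.sum_congr rfl fun i _ => Finset.sum_congr rfl fun b _ => by ring

theorem mode1_one (X : Tensor3 p q k) : mode1 X 1 = X := by
  funext a j c
  simp [mode1, Matrix.one_apply]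

theorem mode1_mode2 (X : Tensor3 p q k) (U : Matrix (Fin q') (Fin q) ℝ)
    (V : Matrix (Fin p') (Fin p) ℝ) : mode1 (mode2 X U) V = mode2 (mode1 X V) U := by
  funext a b c
  simp only [mode1, mode2, Finset.sum_mul]
  rw [Finset.sum_comm]
  exact Finset.sum_congr rfl fun i _ => Finset.sum_congr rfl fun b _ => by ring

theorem mode1_mode3 (X : Tensor3 p q k) (U : Matrix (Fin k') (Fin k) ℝ)
    (V : Matrix (Fin p') (Fin p) ℝ) : mode1 (mode3 X U) V = mode3 (mode1 X V) U := by
  funext a b c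
  simp only [mode1, mode3, Finset.sum_mul]
  rw [Finset.sum_comm]
  exact Finset.sum_congr rfl fun i _ => Finset.sum_congr rfl fun b _ => by ring

theorem mode2_mode3 (X : Tensor3 p q k) (U : Matrix (Fin k') (Fin k) ℝ)
    (V : Matrix (Fin q') (Fin q) ℝ) : mode2 (mode3 X U) V = mode3 (mode2 X V) U := by
  funext a b c
  simp only [mode2, mode3, Finset.sum_mul]
  rw [Finset.sum_comm]
  exact Finset.sum_congr rfl fun i _ => Finset.sum_congr rfl fun b _ => by ring

/-- Mode products commute, so each factor can be applied last; the matching matricization then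
factors through that matrix and has rank at most its number of columns. -/
theorem tuckerRankLE_mode {r l m : ℕ} (G : Tensor3 r l m) (U₁ : Matrix (Fin p) (Fin r) ℝ)
    (U₂ : Matrix (Fin q) (Fin l) ℝ) (U₃ : Matrix (Fin k) (Fin m) ℝ) :
    TuckerRankLE (mode3 (mode2 (mode1 G U₁) U₂) U₃) r l m := by
  have aux : ∀ {a b : ℕ} {ι : Type} [Fintype ι] (U : Matrix (Fin a) (Fin b) ℝ)
      (Y : Matrix (Fin b) ι ℝ), (U * Y).rank ≤ b := fun U Y =>
    (Matrix.rank_mul_le_left U Y).trans (by simpa using U.rank_le_width)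
  refine ⟨?_, ?_, ?_⟩
  · rw [← mode1_mode2, ← mode1_mode3]
    refine le_of_eq_of_le (congrArg Matrix.rank ?_) (aux U₁ (matricize1 (mode3 (mode2 G U₂) U₃)))
    ext i x
    simp only [matricize1, mode1, Matrix.of_apply, Matrix.mul_apply]
    exact Finset.sum_congr rfl fun _ _ => mul_comm _ _
  · rw [← mode2_mode3]
    refine le_of_eq_of_le (congrArg Matrix.rank ?_) (aux U₂ (matricize2 (mode3 (mode1 G U₁) U₃)))
    ext i x
    simp only [matricize2, mode2, Matrix.of_apply, Matrix.mul_apply]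
    exact Finset.sum_congr rfl fun _ _ => mul_comm _ _
  · refine le_of_eq_of_le (congrArg Matrix.rank ?_) (aux U₃ (matricize3 (mode2 (mode1 G U₁) U₂)))
    ext i x
    simp only [matricize3, mode3, Matrix.of_apply, Matrix.mul_apply]
    exact Finset.sum_congr rfl fun _ _ => mul_comm _ _

theorem abs_mode1_le {X : Tensor3 p q k} {U : Matrix (Fin p') (Fin p) ℝ} {x y : ℝ}
    (hX : ∀ i j c, |X i j c| ≤ x) (hU : ∀ a i, |U a i| ≤ y) (a : Fin p') (j : Fin q) (c : Fin k) :
    |mode1 X U a j c| ≤ p * (x * y) := by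
  refine (Finset.abs_sum_le_sum_abs _ _).trans
    ((Finset.sum_le_card_nsmul _ _ (x * y) fun i _ => ?_).trans_eq (by simp))
  rw [abs_mul]
  exact mul_le_mul (hX _ _ _) (hU _ _) (abs_nonneg _) ((abs_nonneg _).trans (hX i j c))

end TensorBounds

/-! ### Spectral norms and perturbation of matrix inverses. -/

section SpectralNorm

variable {d : ℕ}

theorem specNorm_nonneg (T : Matrix (Fin d) (Fin d) ℝ) : 0 ≤ specNorm T := norm_nonneg _

theorem specNorm_mul_le (T T' : Matrix (Fin d) (Fin d) ℝ) :
    specNorm (T * T') ≤ specNorm T * specNorm T' := by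
  unfold specNorm; rw [map_mul]; exact norm_mul_le _ _

theorem specNorm_add_le (T T' : Matrix (Fin d) (Fin d) ℝ) :
    specNorm (T + T') ≤ specNorm T + specNorm T' := by
  unfold specNorm; rw [map_add]; exact norm_add_le _ _

theorem abs_entry_le_specNorm (T : Matrix (Fin d) (Fin d) ℝ) (i j : Fin d) :
    |T i j| ≤ specNorm T := by
  have h := (Matrix.toEuclideanCLM (𝕜 := ℝ) T).le_opNorm (EuclideanSpace.single j 1)
  have h2 := abs_apply_le_norm (Matrix.toEuclideanCLM (𝕜 := ℝ) T (EuclideanSpace.single j 1)) i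
  have e : (Matrix.toEuclideanCLM (𝕜 := ℝ) T (EuclideanSpace.single j 1)) i = T i j := by
    simp [Matrix.ofLp_toEuclideanCLM]
  rw [e] at h2
  exact h2.trans (h.trans_eq (by simp [specNorm]))

theorem norm_le_sum_abs (x : EuclideanSpace ℝ (Fin d)) : ‖x‖ ≤ ∑ i, |x i| := by
  rw [EuclideanSpace.norm_eq]
  refine Real.sqrt_le_iff.2 ⟨by positivity, ?_⟩
  simp only [Real.norm_eq_abs]
  exact Finset.sum_sq_le_sq_sum_of_nonneg fun i _ => abs_nonneg _

theorem specNorm_le {T : Matrix (Fin d) (Fin d) ℝ} {ε : ℝ} (hε : 0 ≤ ε)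
    (hT : ∀ i j, |T i j| ≤ ε) : specNorm T ≤ d ^ 2 * ε := by
  refine ContinuousLinearMap.opNorm_le_bound _ (by positivity) fun x => ?_
  refine (norm_le_sum_abs _).trans
    ((Finset.sum_le_card_nsmul _ _ (d * (ε * ‖x‖)) fun i _ => ?_).trans_eq ?_)
  · rw [Matrix.ofLp_toEuclideanCLM]
    refine (Finset.abs_sum_le_sum_abs _ _).trans
      ((Finset.sum_le_card_nsmul Finset.univ (fun j => |T i j * x j|) (ε * ‖x‖)
        fun j _ => ?_).trans_eq (by simp))
    rw [abs_mul]
    exact mul_le_mul (hT i j) (abs_apply_le_norm x j) (abs_nonneg _) hε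
  · simp; ring

/-- A small perturbation of an invertible matrix is invertible, with control of the inverse. -/
theorem isUnit_and_specNorm_inv_le {T T' : Matrix (Fin d) (Fin d) ℝ} (hT : IsUnit T)
    (h : specNorm T⁻¹ * specNorm (T - T') ≤ 1 / 2) :
    IsUnit T' ∧ specNorm T'⁻¹ ≤ 2 * specNorm T⁻¹ := by
  have hdet := (Matrix.isUnit_iff_isUnit_det T).1 hT
  have hT' : IsUnit T' := by
    -- The second factor is invertible by the Neumann series, its perturbation having norm at most
    -- `1 / 2`.
    have e : T' = T * (1 - T⁻¹ * (T - T')) := by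
      rw [mul_sub, mul_one, Matrix.mul_nonsing_inv_cancel_left _ _ hdet]; abel
    rw [e]
    refine hT.mul ?_
    rw [← MulEquiv.isUnit_map (Matrix.toEuclideanCLM (𝕜 := ℝ) (n := Fin d)), map_sub, map_one]
    refine isUnit_one_sub_of_norm_lt_one ?_
    exact ((specNorm_mul_le _ _).trans h).trans_lt (by norm_num)
  have hdet' := (Matrix.isUnit_iff_isUnit_det T').1 hT'
  refine ⟨hT', ?_⟩
  -- Resolvent identity: the last term has norm at most half that of `T'⁻¹` and is absorbed on the
  -- left.
  have e : T'⁻¹ = T⁻¹ + T'⁻¹ * ((T - T') * T⁻¹) := by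
    rw [sub_mul, mul_sub, Matrix.mul_nonsing_inv _ hdet, Matrix.nonsing_inv_mul_cancel_left _ _ hdet',
      mul_one]; abel
  have h1 : specNorm T'⁻¹ ≤ specNorm T⁻¹ + specNorm T'⁻¹ * (specNorm (T - T') * specNorm T⁻¹) := by
    conv_lhs => rw [e]
    refine (specNorm_add_le _ _).trans ?_
    gcongr
    refine (specNorm_mul_le _ _).trans ?_
    gcongr
    · exact specNorm_nonneg _
    · exact specNorm_mul_le _ _
  have := specNorm_nonneg T'⁻¹
  nlinarith

theorem mode1_inv_mode1 {q k : ℕ} {T : Matrix (Fin d) (Fin d) ℝ} (hT : IsUnit T)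
    (X : Tensor3 d q k) : mode1 (mode1 X T) T⁻¹ = X := by
  rw [mode1_mode1, Matrix.nonsing_inv_mul _ ((Matrix.isUnit_iff_isUnit_det T).1 hT), mode1_one]

/-- Perturbation of `F ×₁ Σ⁻¹`. -/
theorem abs_mode1_inv_sub_le {q k : ℕ} {T T' : Matrix (Fin d) (Fin d) ℝ} (hT : IsUnit T)
    {F F' : Tensor3 d q k} {b η ε : ℝ} (hε : 0 ≤ ε) (hF : ∀ i j c, |F i j c| ≤ b)
    (hFF' : ∀ i j c, |F' i j c - F i j c| ≤ η) (hTT' : ∀ i j, |T' i j - T i j| ≤ ε)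
    (hsmall : specNorm T⁻¹ * (d ^ 2 * ε) ≤ 1 / 2) (a : Fin d) (j : Fin q) (c : Fin k) :
    |mode1 F' T'⁻¹ a j c - mode1 F T⁻¹ a j c| ≤
      d * ((η + d * (d * (b * specNorm T⁻¹) * ε)) * (2 * specNorm T⁻¹)) := by
  have hs := specNorm_nonneg T⁻¹
  have hTT : specNorm (T - T') ≤ d ^ 2 * ε := specNorm_le hε fun i j => by
    rw [Matrix.sub_apply, abs_sub_comm]; exact hTT' i j
  obtain ⟨hT', hinv⟩ := isUnit_and_specNorm_inv_le hT
    ((mul_le_mul_of_nonneg_left hTT hs).trans hsmall)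
  set P := mode1 F T⁻¹ with hP
  have hPb : ∀ i j c, |P i j c| ≤ d * (b * specNorm T⁻¹) :=
    abs_mode1_le hF fun a i => abs_entry_le_specNorm _ _ _
  have hFP : F = mode1 P T := by
    rw [hP, mode1_mode1, Matrix.mul_nonsing_inv _ ((Matrix.isUnit_iff_isUnit_det T).1 hT),
      mode1_one]
  have hPT : P = mode1 (mode1 P T') T'⁻¹ := (mode1_inv_mode1 hT' P).symm
  -- Factoring out `T'⁻¹` avoids comparing inverses: what remains is `F' - P ×₁ T' = (F' - F) + P ×₁
  -- (T - T')`, small entry by entry.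
  have e : mode1 F' T'⁻¹ a j c - P a j c = mode1 (F' - mode1 P T') T'⁻¹ a j c := by
    conv_lhs => rw [hPT]
    simp only [mode1, Pi.sub_apply, sub_mul, Finset.sum_sub_distrib]
  rw [e]
  refine abs_mode1_le (fun i j c => ?_)
    (fun a i => (abs_entry_le_specNorm _ _ _).trans hinv) a j c
  have e2 : (F' - mode1 P T') i j c = (F' i j c - F i j c) + mode1 P (T - T') i j c := by
    conv_rhs => rw [hFP]
    simp only [mode1, Pi.sub_apply, Matrix.sub_apply, mul_sub, Finset.sum_sub_distrib]
    ring
  rw [e2]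
  refine (abs_add_le _ _).trans (add_le_add (hFF' i j c) ?_)
  exact abs_mode1_le hPb (fun i j => by
    rw [Matrix.sub_apply, abs_sub_comm]; exact hTT' i j) i j c

end SpectralNorm

/-! ### Moving mode products through contractions. -/

section Contract

variable {p q k p' q' k' : ℕ}

theorem contract12_mode1 (X : Tensor3 p q k) (U : Matrix (Fin p') (Fin p) ℝ) (f : Fin p' → ℝ)
    (g : Fin q → ℝ) : contract12 (mode1 X U) f g = contract12 X (Uᵀ *ᵥ f) g := by
  funext c
  simp only [contract12, mode1, Matrix.mulVec, dotProduct, Matrix.transpose_apply,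
    Finset.mul_sum, Finset.sum_mul]
  rw [Finset.sum_comm, Finset.sum_comm (s := Finset.univ (α := Fin p))]
  refine Finset.sum_congr rfl fun j _ => ?_
  rw [Finset.sum_comm]
  exact Finset.sum_congr rfl fun i _ => Finset.sum_congr rfl fun a _ => by ring

theorem contract12_mode2 (X : Tensor3 p q k) (U : Matrix (Fin q') (Fin q) ℝ) (f : Fin p → ℝ)
    (g : Fin q' → ℝ) : contract12 (mode2 X U) f g = contract12 X f (Uᵀ *ᵥ g) := by
  funext c
  simp only [contract12, mode2, Matrix.mulVec, dotProduct, Matrix.transpose_apply,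
    Finset.mul_sum, Finset.sum_mul]
  refine Finset.sum_congr rfl fun i _ => ?_
  rw [Finset.sum_comm]
  exact Finset.sum_congr rfl fun j _ => Finset.sum_congr rfl fun b _ => by ring

theorem contract12_mode3 (X : Tensor3 p q k) (U : Matrix (Fin k') (Fin k) ℝ) (f : Fin p → ℝ)
    (g : Fin q → ℝ) : contract12 (mode3 X U) f g = U *ᵥ contract12 X f g := by
  funext c
  simp only [contract12, mode3, Matrix.mulVec, dotProduct, Finset.mul_sum, Finset.sum_mul]
  conv_rhs => rw [Finset.sum_comm]
  refine Finset.sum_congr rfl fun i _ => ?_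
  conv_rhs => rw [Finset.sum_comm]
  exact Finset.sum_congr rfl fun j _ => Finset.sum_congr rfl fun d _ => by ring

end Contract

/-! ### Features -/

section KernelBounds

variable {X H : Type*} [NormedAddCommGroup H] [InnerProductSpace ℝ H] [CompleteSpace H]
  [RKHS ℝ H X ℝ]

theorem inner_kerFun_one (x : X) (f : H) : inner ℝ (RKHS.kerFun H x (1 : ℝ)) f = f x := by
  rw [RKHS.kerFun_inner]; simp

theorem kernelDiag_eq_norm_sq (x : X) : kernelDiag H x = ‖RKHS.kerFun H x (1 : ℝ)‖ ^ 2 := by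
  rw [← real_inner_self_eq_norm_sq, inner_kerFun_one, RKHS.kerFun_apply, kernelDiag]

/-- Reproducing property and Cauchy–Schwarz. -/
theorem apply_sq_le (f : H) (x : X) : f x ^ 2 ≤ kernelDiag H x * ‖f‖ ^ 2 := by
  rw [kernelDiag_eq_norm_sq, ← inner_kerFun_one x f, ← mul_pow]
  exact sq_le_sq' (neg_le_of_abs_le (abs_real_inner_le_norm _ _)) (real_inner_le_norm _ _)

theorem kerFun_one_eq_sum {d : ℕ} (φ : OrthonormalBasis (Fin d) ℝ H) (x : X) :
    RKHS.kerFun H x (1 : ℝ) = ∑ k, φ k x • φ k := by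
  rw [← φ.sum_repr (RKHS.kerFun H x (1 : ℝ))]
  refine Finset.sum_congr rfl fun k _ => ?_
  rw [φ.repr_apply_apply, real_inner_comm, inner_kerFun_one]

end KernelBounds

theorem apply_sum_smul {X H ι : Type*} [NormedAddCommGroup H] [InnerProductSpace ℝ H]
    [RKHS ℝ H X ℝ] (s : Finset ι) (c : ι → ℝ) (f : ι → H) (x : X) :
    (∑ i ∈ s, c i • f i) x = ∑ i ∈ s, c i * f i x := by
  rw [← RKHS.coeCLM_apply (𝕜 := ℝ), map_sum]; simp

/-! ### Existence of the transition tensor. -/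

section TransitionTensor

variable {S A HS HA : Type*} [MeasurableSpace S] [MeasurableSpace A] {M : Model S A}
  [NormedAddCommGroup HS] [InnerProductSpace ℝ HS] [RKHS ℝ HS S ℝ]
  [NormedAddCommGroup HA] [InnerProductSpace ℝ HA] [RKHS ℝ HA A ℝ] {dS dA : ℕ}
  (φ : OrthonormalBasis (Fin dS) ℝ HS) (ψ : Module.Basis (Fin dA) ℝ HA)

/-- The transition tensor exists and has Tucker rank at most `(r, l, m)`, in factored form. -/
theorem exists_isTransitionTensor {r l m : ℕ} (h : OperatorTuckerRankLE M HS HA r l m) :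
    ∃ (G : Tensor3 r l m) (U₁ : Matrix (Fin dS) (Fin r) ℝ) (U₂ : Matrix (Fin dA) (Fin l) ℝ)
      (U₃ : Matrix (Fin dS) (Fin m) ℝ),
      IsTransitionTensor M φ ψ (mode3 (mode2 (mode1 G U₁) U₂) U₃) := by
  obtain ⟨c, u, v, w, h⟩ := h
  -- The factor matrices hold the coordinates of `u`, `v`, `w` in the bases; the operator is then
  -- tested on `f = φ k`.
  refine ⟨c, Matrix.of fun a i => φ.repr (u i) a, Matrix.of fun b j => ψ.repr (v j) b,
    Matrix.of fun k i => inner ℝ (φ k) (w i), fun s a k => ?_⟩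
  have hu : ∀ i, u i s = ∑ x, φ.repr (u i) x * φ x s := fun i => by
    conv_lhs => rw [← φ.sum_repr (u i)]
    rw [apply_sum_smul]
  have hv : ∀ j, v j a = ∑ x, ψ.repr (v j) x * ψ x a := fun j => by
    conv_lhs => rw [← ψ.sum_repr (v j)]
    rw [apply_sum_smul]
  rw [h]
  rw [contract12_mode3, contract12_mode2, contract12_mode1]
  have hu' : (Matrix.of fun a i => φ.repr (u i) a)ᵀ *ᵥ featureVec φ s = fun i => u i s := by
    funext i; rw [hu]; rfl
  have hv' : (Matrix.of fun b j => ψ.repr (v j) b)ᵀ *ᵥ featureVec ψ a = fun j => v j a := by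
    funext j; rw [hv]; rfl
  rw [hu', hv']
  simp only [contract12, Matrix.mulVec, dotProduct, Matrix.of_apply, Finset.mul_sum]
  rw [Finset.sum_comm]
  refine Finset.sum_congr rfl fun i _ => ?_
  rw [Finset.sum_comm]
  exact Finset.sum_congr rfl fun j _ => Finset.sum_congr rfl fun x _ => by ring

theorem isTransitionTensor_transitionTensor {r l m : ℕ} (h : OperatorTuckerRankLE M HS HA r l m) :
    IsTransitionTensor M φ ψ (transitionTensor M φ ψ) := by
  obtain ⟨G, U₁, U₂, U₃, hG⟩ := exists_isTransitionTensor φ ψ h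
  exact Classical.epsilon_spec (p := fun T => IsTransitionTensor M φ ψ T) ⟨_, hG⟩

end TransitionTensor

section Features

variable {S A : Type*} [MeasurableSpace S] [MeasurableSpace A] {M : Model S A}
variable {HS : Type*} [NormedAddCommGroup HS] [InnerProductSpace ℝ HS] [CompleteSpace HS]
  [RKHS ℝ HS S ℝ]
variable {HA : Type*} [NormedAddCommGroup HA] [InnerProductSpace ℝ HA] [CompleteSpace HA]
  [RKHS ℝ HA A ℝ]
variable {dS dA : ℕ} (φ : OrthonormalBasis (Fin dS) ℝ HS) (ψ : Module.Basis (Fin dA) ℝ HA)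

theorem BoundedModel.sq_le_Kmax (h : BoundedModel M HS HA) (i : Fin dS) (s : S) :
    φ i s ^ 2 ≤ Kmax S A HS HA := by
  refine (apply_sq_le (φ i) s).trans ?_
  rw [φ.norm_eq_one, one_pow, mul_one]
  exact (le_ciSup h.1 s).trans (le_max_left _ _)

theorem BoundedModel.Kmax_nonneg (h : BoundedModel M HS HA) : 0 ≤ Kmax S A HS HA := by
  obtain ⟨s₀⟩ : Nonempty S := nonempty_of_isProbabilityMeasure M.xi
  refine le_trans ?_ ((le_ciSup h.1 s₀).trans (le_max_left _ _))
  rw [kernelDiag_eq_norm_sq]; positivity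

theorem BoundedModel.abs_le_sqrt_Kmax (h : BoundedModel M HS HA) (i : Fin dS) (s : S) :
    |φ i s| ≤ √(Kmax S A HS HA) :=
  Real.abs_le_sqrt (h.sq_le_Kmax φ i s)

/-- Kept existential because `ψ` is not normalized in `HA`: the bound serves integrability and
boundedness only and never enters the rate. -/
theorem BoundedModel.exists_abs_le (h : BoundedModel M HS HA) :
    ∃ b : ℝ, ∀ j a, |ψ j a| ≤ b := by
  obtain ⟨K, hK⟩ := h.2.1
  refine ⟨∑ j, √(K * ‖ψ j‖ ^ 2), fun j a => ?_⟩
  refine (Real.abs_le_sqrt ?_).trans (Finset.single_le_sum (f := fun j => √(K * ‖ψ j‖ ^ 2))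
    (fun _ _ => Real.sqrt_nonneg _) (Finset.mem_univ j))
  exact (apply_sq_le (ψ j) a).trans
    (mul_le_mul_of_nonneg_right (hK ⟨a, rfl⟩) (sq_nonneg _))

variable (M) in
theorem weight_pos (s : S) (a : A) : 0 < M.weight s a :=
  div_pos (M.etaDens_pos a) (M.piDens_pos s a)

theorem BoundedModel.weight_le (h : BoundedModel M HS HA) (s : S) (a : A) :
    M.weight s a ≤ M.kappa :=
  le_ciSup h.2.2 (s, a)

variable (M) in
theorem measurable_weight : Measurable fun x : S × A => M.weight x.1 x.2 := by
  have h1 := M.etaDens_measurable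
  have h2 : Measurable fun x : S × A => M.piDens x.1 x.2 := M.piDens_measurable
  exact ((h1.comp measurable_snd).coe_nnreal_real).div h2.coe_nnreal_real

instance isProbabilityMeasure_eta : IsProbabilityMeasure M.eta :=
  ⟨by rw [Model.eta, withDensity_apply _ MeasurableSet.univ, Measure.restrict_univ,
    M.etaDens_lintegral]⟩

/-- Importance weighting turns the behavior policy into `η`. -/
theorem integral_weight_mul (M : Model S A) (s : S) (f : A → ℝ) :
    ∫ a, M.weight s a * f a ∂M.policy s = ∫ a, f a ∂M.eta := by
  have h2 : Measurable (M.piDens s) := M.piDens_measurable.comp measurable_prodMk_left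
  rw [M.policy_eq, Model.eta, integral_withDensity_eq_integral_smul h2,
    integral_withDensity_eq_integral_smul M.etaDens_measurable]
  refine integral_congr_ae (.of_forall fun a => ?_)
  have := (NNReal.coe_pos.2 (M.piDens_pos s a)).ne'
  simp only [NNReal.smul_def, smul_eq_mul, Model.weight]
  field_simp

/-- The kernel section at `s` has coordinates `φ k s`, so the vector-valued integral is taken
coordinatewise. -/
theorem meanEmbedding_eq_sum (hφ : ∀ f : HS, Measurable fun s : S => f s) {b : ℝ}
    (hb : ∀ k s, |φ k s| ≤ b) (ν : Measure S) [IsProbabilityMeasure ν] :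
    meanEmbedding HS ν = ∑ k, (∫ s, φ k s ∂ν) • φ k := by
  unfold meanEmbedding
  simp only [kerFun_one_eq_sum φ]
  rw [integral_finsetSum _ fun k _ =>
    (integrable_of_abs_le (hφ (φ k)) (hb k)).smul_const (φ k)]
  exact Finset.sum_congr rfl fun k _ => integral_smul_const _ _

theorem exists_transitionTensor_eq {r l m : ℕ} (h : OperatorTuckerRankLE M HS HA r l m) :
    ∃ (G : Tensor3 r l m) (U₁ : Matrix (Fin dS) (Fin r) ℝ) (U₂ : Matrix (Fin dA) (Fin l) ℝ)
      (U₃ : Matrix (Fin dS) (Fin m) ℝ),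
      transitionTensor M φ ψ = mode3 (mode2 (mode1 G U₁) U₂) U₃ := by
  obtain ⟨G, U₁, U₂, U₃, hG⟩ := exists_isTransitionTensor φ ψ h
  exact ⟨G, U₁, U₂, U₃, (isTransitionTensor_transitionTensor φ ψ h).unique hG⟩

end Features

/-! ### The deterministic clustering bound -/

section Partition

variable {X Y : Type*} [MeasurableSpace X] [MeasurableSpace Y]

theorem IsPartition.sum_setIntegral_prod {k l : ℕ} {P : Fin k → Set X} {Q : Fin l → Set Y}
    (hP : IsPartition P) (hQ : IsPartition Q) {μ : Measure (X × Y)} {f : X × Y → ℝ}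
    (hf : Integrable f μ) : ∑ i, ∑ j, ∫ x in P i ×ˢ Q j, f x ∂μ = ∫ x, f x ∂μ := by
  have hU : ⋃ x : Fin k × Fin l, P x.1 ×ˢ Q x.2 = Set.univ := by
    refine Set.eq_univ_of_forall fun y => ?_
    obtain ⟨i, hi⟩ := Set.mem_iUnion.1 (hP.2.2.symm ▸ Set.mem_univ y.1 : y.1 ∈ ⋃ i, P i)
    obtain ⟨j, hj⟩ := Set.mem_iUnion.1 (hQ.2.2.symm ▸ Set.mem_univ y.2 : y.2 ∈ ⋃ i, Q i)
    exact Set.mem_iUnion.2 ⟨(i, j), hi, hj⟩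
  have hd : Pairwise (Function.onFun Disjoint fun x : Fin k × Fin l => P x.1 ×ˢ Q x.2) := by
    rintro ⟨i, j⟩ ⟨i', j'⟩ h
    rw [Function.onFun, Set.disjoint_prod]
    by_cases hi : i = i'
    · exact Or.inr (hQ.2.1 fun hj => h (Prod.ext hi hj))
    · exact Or.inl (hP.2.1 hi)
  have e := integral_iUnion_fintype (s := fun x : Fin k × Fin l => P x.1 ×ˢ Q x.2)
    (fun x => (hP.1 x.1).prod (hQ.1 x.2)) hd fun x => hf.integrableOn
  rw [hU, setIntegral_univ, Fintype.sum_prod_type] at e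
  exact e.symm

theorem integrable_norm_sub_sq {E : Type*} [NormedAddCommGroup E] {μ : Measure X}
    [IsFiniteMeasure μ] {f g : X → E} (hf : AEStronglyMeasurable f μ)
    (hg : AEStronglyMeasurable g μ) {b c : ℝ} (hb : ∀ x, ‖f x‖ ≤ b) (hc : ∀ x, ‖g x‖ ≤ c) :
    Integrable (fun x => ‖f x - g x‖ ^ 2) μ := by
  refine Integrable.of_bound ((hf.sub hg).norm.pow 2) ((b + c) ^ 2) (.of_forall fun x => ?_)
  rw [norm_pow, norm_norm]
  exact pow_le_pow_left₀ (norm_nonneg _)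
    ((norm_sub_le _ _).trans (add_le_add (hb x) (hc x))) 2

theorem norm_add_sq_le_two {E : Type*} [NormedAddCommGroup E] (x y : E) :
    ‖x + y‖ ^ 2 ≤ 2 * ‖x‖ ^ 2 + 2 * ‖y‖ ^ 2 := by
  have := pow_le_pow_left₀ (norm_nonneg _) (norm_add_le x y) 2
  nlinarith [sq_nonneg (‖x‖ - ‖y‖)]

/-- Summing over the blocks a pointwise bound `f i j ≤ 2 g + 2 f' i j`. -/
theorem IsPartition.sum_setIntegral_le {k l : ℕ} {P : Fin k → Set X} {Q : Fin l → Set Y}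
    (hP : IsPartition P) (hQ : IsPartition Q) {μ : Measure (X × Y)} {g : X × Y → ℝ}
    {f f' : Fin k → Fin l → X × Y → ℝ} (hg : Integrable g μ) (hf : ∀ i j, Integrable (f i j) μ)
    (hf' : ∀ i j, Integrable (f' i j) μ) (hle : ∀ i j x, f i j x ≤ 2 * g x + 2 * f' i j x) :
    ∑ i, ∑ j, ∫ x in P i ×ˢ Q j, f i j x ∂μ ≤
      2 * ∫ x, g x ∂μ + 2 * ∑ i, ∑ j, ∫ x in P i ×ˢ Q j, f' i j x ∂μ := by
  rw [← hP.sum_setIntegral_prod hQ hg, Finset.mul_sum, Finset.mul_sum, ← Finset.sum_add_distrib]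
  refine Finset.sum_le_sum fun i _ => ?_
  rw [Finset.mul_sum, Finset.mul_sum, ← Finset.sum_add_distrib]
  refine Finset.sum_le_sum fun j _ => ?_
  rw [← integral_const_mul, ← integral_const_mul, ← integral_add
    (hg.integrableOn.const_mul 2) ((hf' i j).integrableOn.const_mul 2)]
  exact integral_mono (hf i j).integrableOn
    ((hg.integrableOn.const_mul 2).add ((hf' i j).integrableOn.const_mul 2)) (hle i j)

end Partition

section Clustering

variable {S A : Type*} [MeasurableSpace S] [MeasurableSpace A] {M : Model S A}
variable {HS : Type*} [NormedAddCommGroup HS] [InnerProductSpace ℝ HS] [CompleteSpace HS]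
  [RKHS ℝ HS S ℝ]

/-- Decoding is an isometry. -/
theorem exists_decode_isometry {HS : Type*} [NormedAddCommGroup HS] [InnerProductSpace ℝ HS]
    {dS m : ℕ} (φ : OrthonormalBasis (Fin dS) ℝ HS)
    {U₃ : Matrix (Fin dS) (Fin m) ℝ} (hU : U₃ᵀ * U₃ = 1) :
    ∃ J : EuclideanSpace ℝ (Fin m) →ₗᵢ[ℝ] HS, ∀ z, J z = decode φ U₃ z := by
  let J₀ : EuclideanSpace ℝ (Fin m) →ₗ[ℝ] HS :=
    φ.repr.symm.toLinearEquiv.toLinearMap ∘ₗ Matrix.toEuclideanLin U₃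
  have hJ : ∀ z, J₀ z = decode φ U₃ z := fun z => by
    simp only [J₀, decode, LinearMap.comp_apply]
    refine (φ.sum_repr_symm _).symm.trans ?_
    rfl
  refine ⟨⟨J₀, fun z => ?_⟩, hJ⟩
  have h1 : ‖J₀ z‖ = ‖Matrix.toEuclideanLin U₃ z‖ := φ.repr.symm.norm_map _
  rw [h1, ← sq_eq_sq₀ (norm_nonneg _) (norm_nonneg _), ← real_inner_self_eq_norm_sq,
    ← real_inner_self_eq_norm_sq]
  simp only [EuclideanSpace.inner_eq_star_dotProduct, Matrix.ofLp_toLpLin, Matrix.toLin'_apply]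
  simp only [star_trivial]
  rw [Matrix.dotProduct_mulVec, Matrix.vecMul_mulVec, hU, Matrix.vecMul_one]

/-- If the empirical embedding `J ∘ Φ` is within `D` of the true one in mean square, then an optimal
clustering for `Φ` has loss at most `6 D + 4 L*`. -/
theorem IsClusterSolution.partitionLoss_le {m ns na : ℕ}
    (J : EuclideanSpace ℝ (Fin m) →ₗᵢ[ℝ] HS) {Φ : S → A → EuclideanSpace ℝ (Fin m)}
    {P : Fin ns → Set S} {Q : Fin na → Set A} {z : Fin ns → Fin na → EuclideanSpace ℝ (Fin m)}
    (h : IsClusterSolution M Φ P Q z)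
    (hΦ : AEStronglyMeasurable (fun x : S × A => Φ x.1 x.2) (M.xi.prod M.eta)) {b : ℝ}
    (hb : ∀ x : S × A, ‖Φ x.1 x.2‖ ≤ b)
    (he : AEStronglyMeasurable (fun x : S × A => meanEmbedding HS (M.trans x)) (M.xi.prod M.eta))
    {c : ℝ} (hc : ∀ x : S × A, ‖meanEmbedding HS (M.trans x)‖ ≤ c) :
    partitionLoss M P Q (fun i j => J (z i j)) ≤
      6 * ∫ x, ‖meanEmbedding HS (M.trans x) - J (Φ x.1 x.2)‖ ^ 2 ∂(M.xi.prod M.eta) +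
      4 * optimalLoss M HS ns na := by
  set D := ∫ x, ‖meanEmbedding HS (M.trans x) - J (Φ x.1 x.2)‖ ^ 2 ∂(M.xi.prod M.eta) with hD
  obtain ⟨hP, hQ, hopt⟩ := h
  have hJΦ : AEStronglyMeasurable (fun x : S × A => J (Φ x.1 x.2)) (M.xi.prod M.eta) :=
    J.continuous.comp_aestronglyMeasurable hΦ
  have hJb : ∀ x : S × A, ‖J (Φ x.1 x.2)‖ ≤ b := fun x => by rw [J.norm_map]; exact hb x
  have iD := integrable_norm_sub_sq he hJΦ hc hJb
  have iE : ∀ q : HS, Integrable (fun x => ‖meanEmbedding HS (M.trans x) - q‖ ^ 2)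
      (M.xi.prod M.eta) := fun q =>
    integrable_norm_sub_sq he aestronglyMeasurable_const hc fun _ => le_rfl
  have iΦ : ∀ y : EuclideanSpace ℝ (Fin m), Integrable (fun x : S × A => ‖Φ x.1 x.2 - y‖ ^ 2)
      (M.xi.prod M.eta) := fun y =>
    integrable_norm_sub_sq hΦ aestronglyMeasurable_const hb fun _ => le_rfl
  -- Pass from the true embedding to `J ∘ Φ`, where `J` preserves the distance to the cluster
  -- centre.
  have h1 : partitionLoss M P Q (fun i j => J (z i j)) ≤ 2 * D + 2 * clusterLoss M Φ P Q z := by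
    refine hP.sum_setIntegral_le hQ iD (fun i j => iE _) (fun i j => iΦ _) fun i j x => ?_
    rw [← J.norm_map (Φ x.1 x.2 - z i j), map_sub]
    refine le_trans (le_of_eq ?_) (norm_add_sq_le_two _ _)
    rw [sub_add_sub_cancel]
  -- The adjoint of `J` pulls an arbitrary `q` in `HS` back to an admissible centre. It is a
  -- contraction with `J* J = 1`, so distances do not grow.
  have hJadj : ∀ (y : EuclideanSpace ℝ (Fin m)) (q : HS),
      ‖y - J.toContinuousLinearMap.adjoint q‖ ≤ ‖J y - q‖ := fun y q => by
    have e : J.toContinuousLinearMap.adjoint (J y) = y := by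
      refine ext_inner_right ℝ fun w => ?_
      rw [ContinuousLinearMap.adjoint_inner_left]
      exact J.inner_map_map y w
    conv_lhs => rw [← e, ← map_sub]
    refine (ContinuousLinearMap.le_opNorm _ _).trans (mul_le_of_le_one_left (norm_nonneg _) ?_)
    rw [ContinuousLinearMap.adjoint.norm_map]
    exact J.norm_toContinuousLinearMap_le
  have h2 : ∀ (P' : Fin ns → Set S) (Q' : Fin na → Set A) (q : Fin ns → Fin na → HS),
      IsPartition P' → IsPartition Q' →
      clusterLoss M Φ P Q z ≤ 2 * D + 2 * partitionLoss M P' Q' q := fun P' Q' q hP' hQ' => by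
    refine (hopt P' Q' (fun i j => J.toContinuousLinearMap.adjoint (q i j)) hP' hQ').trans ?_
    refine hP'.sum_setIntegral_le hQ' iD (fun i j => iΦ _) (fun i j => iE _) fun i j x => ?_
    refine (pow_le_pow_left₀ (norm_nonneg _) (hJadj _ _) 2).trans ?_
    rw [norm_sub_rev (meanEmbedding HS (M.trans x))]
    refine le_trans (le_of_eq ?_) (norm_add_sq_le_two _ _)
    rw [sub_add_sub_cancel]
  obtain ⟨s₀⟩ : Nonempty S := nonempty_of_isProbabilityMeasure M.xi
  -- Combining, the loss is at most `2 D + 2 (2 D + 2 L) = 6 D + 4 L` for every competitor. The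
  -- infimum is over a nonempty set: the partitions at hand with all distributions equal to `ξ`.
  have h3 : (partitionLoss M P Q (fun i j => J (z i j)) - 6 * D) / 4 ≤ optimalLoss M HS ns na := by
    refine le_csInf ⟨_, P, Q, fun _ _ => ⟨M.xi, inferInstance⟩, hP, hQ, rfl⟩ ?_
    rintro _ ⟨P', Q', q, hP', hQ', rfl⟩
    have := h2 P' Q' (fun i j => meanEmbedding HS (q i j : Measure S)) hP' hQ'
    linarith
  linarith

end Clustering

/-! ### Moments of the estimators -/

theorem empiricalCovariance_apply {S HS : Type*} [NormedAddCommGroup HS]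
    [InnerProductSpace ℝ HS] [RKHS ℝ HS S ℝ] {dS : ℕ} (φ : OrthonormalBasis (Fin dS) ℝ HS)
    (s : ℕ → S) (n : ℕ) (i j : Fin dS) :
    empiricalCovariance φ s n i j = (n : ℝ)⁻¹ * ∑ t ∈ Finset.range n, φ i (s t) * φ j (s t) := by
  simp only [empiricalCovariance, Matrix.smul_apply, Matrix.sum_apply, smul_eq_mul]
  rfl

/-- Markov's inequality for the sum of the squares, which controls all coordinates on one event
without a union bound. -/
theorem exists_event_of_second_moments {Ω ι : Type*} [MeasurableSpace Ω] [Fintype ι]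
    {Pr : Measure Ω} [IsProbabilityMeasure Pr] {Z : ι → Ω → ℝ} (hZ : ∀ i, Measurable (Z i))
    (hi : ∀ i, Integrable (fun ω => Z i ω ^ 2) Pr) {B δ : ℝ} (hB : 0 < B) (hδ : 0 < δ)
    (hv : ∑ i, ∫ ω, Z i ω ^ 2 ∂Pr ≤ B) :
    ∃ E : Set Ω, MeasurableSet E ∧ 1 - δ ≤ Pr.real E ∧ ∀ ω ∈ E, ∀ i, |Z i ω| ≤ √(B / δ) := by
  have hm : Measurable fun ω => ∑ i, Z i ω ^ 2 :=
    Finset.measurable_fun_sum _ fun i _ => (hZ i).pow_const 2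
  have hmE : MeasurableSet {ω | B / δ ≤ ∑ i, Z i ω ^ 2} := hm measurableSet_Ici
  refine ⟨{ω | B / δ ≤ ∑ i, Z i ω ^ 2}ᶜ, hmE.compl, ?_, fun ω hω i => ?_⟩
  · rw [probReal_compl_eq_one_sub hmE]
    have h := mul_meas_ge_le_integral_of_nonneg (μ := Pr) (f := fun ω => ∑ i, Z i ω ^ 2)
      (.of_forall fun ω => Finset.sum_nonneg fun i _ => sq_nonneg _)
      (integrable_finsetSum _ fun i _ => hi i) (B / δ)
    rw [integral_finsetSum _ fun i _ => hi i] at h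
    have h2 := h.trans hv
    rw [div_mul_eq_mul_div, div_le_iff₀ hδ] at h2
    linarith [le_of_mul_le_mul_left h2 hB]
  · refine Real.abs_le_sqrt (le_trans ?_ (not_le.1 (Set.notMem_ofPred_iff.1 hω)).le)
    exact Finset.single_le_sum (f := fun i => Z i ω ^ 2) (fun _ _ => sq_nonneg _)
      (Finset.mem_univ i)

section Moments

variable {S A : Type*} [MeasurableSpace S] [MeasurableSpace A] {M : Model S A}
variable {HS : Type*} [NormedAddCommGroup HS] [InnerProductSpace ℝ HS]
  [RKHS ℝ HS S ℝ]
variable {HA : Type*} [NormedAddCommGroup HA] [InnerProductSpace ℝ HA]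
  [RKHS ℝ HA A ℝ]
variable {dS dA : ℕ} (φ : OrthonormalBasis (Fin dS) ℝ HS) (ψ : Module.Basis (Fin dA) ℝ HA)

variable (M) in
/-- An entry of the importance-weighted sample tensor of one transition. -/
noncomputable def sampleEntry (i : Fin dS) (j : Fin dA) (k : Fin dS) (y : (S × A) × S) : ℝ :=
  M.weight y.1.1 y.1.2 * (φ i y.1.1 * ψ j y.1.2 * φ k y.2)

theorem empiricalTensor_apply (s : ℕ → S) (a : ℕ → A) (n : ℕ) (i : Fin dS) (j : Fin dA)
    (k : Fin dS) : empiricalTensor M φ ψ s a n i j k =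
      (n : ℝ)⁻¹ * ∑ t ∈ Finset.range n, sampleEntry M φ ψ i j k ((s t, a t), s (t + 1)) := by
  simp only [empiricalTensor, Pi.smul_apply, Finset.sum_apply, smul_eq_mul]
  rfl

theorem measurable_sampleEntry (hm : MeasurableSpaces S A HS HA) (i : Fin dS) (j : Fin dA) (k : Fin dS) :
    Measurable (sampleEntry M φ ψ i j k) := by
  have h1 := measurable_weight M
  have h2 := hm.1 (φ i)
  have h3 := hm.2 (ψ j)
  have h4 := hm.1 (φ k)
  exact (h1.comp measurable_fst).mul (((h2.comp (measurable_fst.comp measurable_fst)).mul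
    (h3.comp (measurable_snd.comp measurable_fst))).mul (h4.comp measurable_snd))

theorem step_sampleEntry_eq_integral (i : Fin dS) (j : Fin dA) (k : Fin dS) (s : S) :
    M.step (sampleEntry M φ ψ i j k) s =
      ∫ a, φ i s * ψ j a * ∫ s', φ k s' ∂M.trans (s, a) ∂M.eta := by
  rw [← integral_weight_mul M s, Model.step]
  refine integral_congr_ae (.of_forall fun a => ?_)
  simp only [sampleEntry]
  rw [integral_const_mul, integral_const_mul]

variable [CompleteSpace HS] [CompleteSpace HA]

theorem BoundedModel.kappa_pos (hb : BoundedModel M HS HA) : 0 < M.kappa := by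
  obtain ⟨s₀⟩ : Nonempty S := nonempty_of_isProbabilityMeasure M.xi
  obtain ⟨a₀⟩ : Nonempty A := nonempty_of_isProbabilityMeasure M.eta
  exact (weight_pos M s₀ a₀).trans_le (hb.weight_le s₀ a₀)

theorem BoundedModel.abs_mul_le_Kmax (hb : BoundedModel M HS HA) (i j : Fin dS) (s s' : S) :
    |φ i s * φ j s'| ≤ Kmax S A HS HA := by
  rw [abs_mul]
  refine (mul_le_mul (hb.abs_le_sqrt_Kmax φ i s) (hb.abs_le_sqrt_Kmax φ j s') (abs_nonneg _)
    (Real.sqrt_nonneg _)).trans_eq ?_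
  rw [← sq, Real.sq_sqrt hb.Kmax_nonneg]

theorem exists_abs_sampleEntry_le (hb : BoundedModel M HS HA) (i : Fin dS) (j : Fin dA) (k : Fin dS) :
    ∃ b, ∀ y, |sampleEntry M φ ψ i j k y| ≤ b := by
  obtain ⟨c, hc⟩ := hb.exists_abs_le ψ
  have hκ := hb.kappa_pos
  refine ⟨M.kappa * (Kmax S A HS HA * c), fun y => ?_⟩
  rw [sampleEntry, abs_mul, abs_of_pos (weight_pos M _ _), mul_right_comm (φ i y.1.1), abs_mul]
  have h0 := (abs_nonneg _).trans (hb.abs_mul_le_Kmax φ i k y.1.1 y.2)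
  gcongr
  · exact hb.weight_le _ _
  · exact hb.abs_mul_le_Kmax φ i k _ _
  · exact hc _ _

theorem integrable_psi_mul_psi (hm : MeasurableSpaces S A HS HA)
    (hb : BoundedModel M HS HA) (j j' : Fin dA) : Integrable (fun a => ψ j a * ψ j' a) M.eta := by
  obtain ⟨c, hc⟩ := hb.exists_abs_le ψ
  refine integrable_of_abs_le ((hm.2 (ψ j)).mul (hm.2 (ψ j'))) (b := c * c) fun a => ?_
  rw [abs_mul]
  exact mul_le_mul (hc j a) (hc j' a) (abs_nonneg _) ((abs_nonneg _).trans (hc j a))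

/-- After reweighting to `η`, the conditional mean of `φ k` is a contraction of `T`, and
orthonormality of `ψ` collapses the sum over the action index. -/
theorem step_sampleEntry (hm : MeasurableSpaces S A HS HA)
    (hb : BoundedModel M HS HA) {T : Tensor3 dS dA dS} (hT : IsTransitionTensor M φ ψ T)
    (hψ : IsL2Orthonormal M ψ) (i : Fin dS) (j : Fin dA) (k : Fin dS) (s : S) :
    M.step (sampleEntry M φ ψ i j k) s = ∑ i', T i' j k * (φ i s * φ i' s) := by
  rw [step_sampleEntry_eq_integral φ ψ]
  have e : ∀ a, φ i s * ψ j a * ∫ s', φ k s' ∂M.trans (s, a) =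
      ∑ i', ∑ j', T i' j' k * (φ i s * φ i' s) * (ψ j a * ψ j' a) := fun a => by
    rw [← hT s a k]
    simp only [contract12, featureVec, Finset.mul_sum]
    exact Finset.sum_congr rfl fun i' _ => Finset.sum_congr rfl fun j' _ => by ring
  have hi := integrable_psi_mul_psi ψ hm hb
  rw [integral_congr_ae (.of_forall e), integral_finsetSum _ fun i' _ =>
    integrable_finsetSum _ fun j' _ => (hi j j').const_mul _]
  refine Finset.sum_congr rfl fun i' _ => ?_
  rw [integral_finsetSum _ fun j' _ => (hi j j').const_mul _]
  simp only [integral_const_mul, hψ j, mul_ite, mul_one, mul_zero]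
  rw [Finset.sum_ite_eq]
  simp

/-- No supremum of `ψ` may appear, so `|ψ| ≤ (ψ² + 1) / 2` is used; its right side has `η`-mean one.
-/
theorem abs_step_sampleEntry_le (hm : MeasurableSpaces S A HS HA)
    (hb : BoundedModel M HS HA) (hψ : IsL2Orthonormal M ψ) (i : Fin dS) (j : Fin dA)
    (k : Fin dS) (s : S) : |M.step (sampleEntry M φ ψ i j k) s| ≤ Kmax S A HS HA := by
  have hK := hb.Kmax_nonneg
  rw [step_sampleEntry_eq_integral φ ψ]
  have hi := integrable_psi_mul_psi ψ hm hb j j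
  have hle : ∀ a, |φ i s * ψ j a * ∫ s', φ k s' ∂M.trans (s, a)| ≤
      Kmax S A HS HA * ((1 / 2) * (ψ j a * ψ j a) + 1 / 2) := fun a => by
    rw [mul_right_comm, ← integral_const_mul, abs_mul]
    refine mul_le_mul (abs_integral_le_of_abs_le fun s' => hb.abs_mul_le_Kmax φ i k s s') ?_
      (abs_nonneg _) hK
    rw [← abs_mul_abs_self (ψ j a)]
    nlinarith [sq_nonneg (|ψ j a| - 1)]
  have hi2 : Integrable (fun a => (1 / 2) * (ψ j a * ψ j a) + 1 / 2) M.eta :=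
    (hi.const_mul (1 / 2)).add (integrable_const _)
  refine (norm_integral_le_of_norm_le
    (f := fun a => φ i s * ψ j a * ∫ s', φ k s' ∂M.trans (s, a)) (hi2.const_mul _) (.of_forall hle)).trans_eq ?_
  have e := hψ j j
  rw [if_pos rfl] at e
  have e2 : ∫ a, ((1 / 2) * (ψ j a * ψ j a) + 1 / 2) ∂M.eta = 1 := by
    rw [integral_add (hi.const_mul _) (integrable_const _), integral_const_mul, e]
    simp; norm_num
  exact (integral_const_mul _ _).trans (by rw [e2, mul_one])

/-- Of the two weights in the square, one changes the measure to `η` and the other is at most `κ`;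
then `ψ²` has mean one. -/
theorem step_sampleEntry_sq_le (hm : MeasurableSpaces S A HS HA)
    (hb : BoundedModel M HS HA) (hψ : IsL2Orthonormal M ψ) (i : Fin dS) (j : Fin dA)
    (k : Fin dS) (s : S) :
    M.step (fun y => sampleEntry M φ ψ i j k y ^ 2) s ≤ Kmax S A HS HA ^ 2 * M.kappa := by
  have hK := hb.Kmax_nonneg
  have hκ := hb.kappa_pos
  have hi := integrable_psi_mul_psi ψ hm hb j j
  have e : ∫ a, ψ j a * ψ j a ∂M.eta = 1 := by rw [hψ j j, if_pos rfl]
  have e1 : M.step (fun y => sampleEntry M φ ψ i j k y ^ 2) s =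
      ∫ a, M.weight s a * (ψ j a * ψ j a) * ∫ s', (φ i s * φ k s') ^ 2 ∂M.trans (s, a) ∂M.eta := by
    rw [← integral_weight_mul M s, Model.step]
    refine integral_congr_ae (.of_forall fun a => ?_)
    simp only [sampleEntry]
    rw [← integral_const_mul, ← integral_const_mul]
    refine integral_congr_ae (.of_forall fun s' => ?_)
    simp only; ring
  have hsq : ∀ s', |(φ i s * φ k s') ^ 2| ≤ Kmax S A HS HA ^ 2 := fun s' => by
    rw [abs_pow]; exact pow_le_pow_left₀ (abs_nonneg _) (hb.abs_mul_le_Kmax φ i k s s') 2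
  rw [e1]
  refine (integral_mono_of_nonneg (g := fun a => Kmax S A HS HA ^ 2 * M.kappa * (ψ j a * ψ j a))
    (.of_forall fun a => ?_) (hi.const_mul _) (.of_forall fun a => ?_)).trans_eq ?_
  · exact mul_nonneg (mul_nonneg (weight_pos M s a).le (mul_self_nonneg _))
      (integral_nonneg fun s' => sq_nonneg _)
  · have h1 := hb.weight_le s a
    have h2 : ∫ s', (φ i s * φ k s') ^ 2 ∂M.trans (s, a) ≤ Kmax S A HS HA ^ 2 :=
      (le_abs_self _).trans (abs_integral_le_of_abs_le hsq)
    calc M.weight s a * (ψ j a * ψ j a) * ∫ s', (φ i s * φ k s') ^ 2 ∂M.trans (s, a)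
        ≤ M.kappa * (ψ j a * ψ j a) * Kmax S A HS HA ^ 2 := by
          have := mul_self_nonneg (ψ j a)
          have h0 : 0 ≤ ∫ s', (φ i s * φ k s') ^ 2 ∂M.trans (s, a) :=
            integral_nonneg fun s' => sq_nonneg _
          gcongr
      _ = _ := by ring
  · rw [integral_const_mul, e, mul_one]

/-- Identifies the stationary target of `F̄` as `P ×₁ Σ`, from which `P` is recovered by `Σ⁻¹`. -/
theorem integral_step_sampleEntry (hm : MeasurableSpaces S A HS HA)
    (hb : BoundedModel M HS HA) {T : Tensor3 dS dA dS} (hT : IsTransitionTensor M φ ψ T)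
    (hψ : IsL2Orthonormal M ψ) (i : Fin dS) (j : Fin dA) (k : Fin dS) :
    ∫ s, M.step (sampleEntry M φ ψ i j k) s ∂M.xi = mode1 T (covariance M φ) i j k := by
  simp only [step_sampleEntry φ ψ hm hb hT hψ]
  have hi : ∀ i', Integrable (fun s => φ i s * φ i' s) M.xi := fun i' =>
    integrable_of_abs_le ((hm.1 (φ i)).mul (hm.1 (φ i'))) fun s => hb.abs_mul_le_Kmax φ i i' s s
  rw [integral_finsetSum _ fun i' _ => (hi i').const_mul _]
  simp only [integral_const_mul, mode1, covariance, Matrix.of_apply]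

/-- As an average of conditional means, the target inherits a bound free of `T`, as the threshold
requires. -/
theorem abs_mode1_covariance_le (hm : MeasurableSpaces S A HS HA)
    (hb : BoundedModel M HS HA) {T : Tensor3 dS dA dS} (hT : IsTransitionTensor M φ ψ T)
    (hψ : IsL2Orthonormal M ψ) (i : Fin dS) (j : Fin dA) (k : Fin dS) :
    |mode1 T (covariance M φ) i j k| ≤ Kmax S A HS HA := by
  rw [← integral_step_sampleEntry φ ψ hm hb hT hψ]
  exact abs_integral_le_of_abs_le (abs_step_sampleEntry_le φ ψ hm hb hψ i j k)

/-- A bound for `n` times the total variance of `F̄` and `Σ̂`. -/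
noncomputable def varianceConst (dS dA t : ℕ) (K κ : ℝ) : ℝ :=
  dS * dA * dS * (4 * (K ^ 2 * κ) + 300 * K ^ 2 * t ^ 2) +
    dS * dS * (4 * K ^ 2 + 300 * K ^ 2 * t ^ 2) + 1

theorem exists_concentration_event (hm : MeasurableSpaces S A HS HA)
    (hb : BoundedModel M HS HA) {T : Tensor3 dS dA dS} (hT : IsTransitionTensor M φ ψ T)
    (hψ : IsL2Orthonormal M ψ) (hmix : M.HasFiniteMixingTime) {Ω : Type*} [MeasurableSpace Ω]
    {Pr : Measure Ω} [IsProbabilityMeasure Pr] {X : ℕ → Ω → S} {U : ℕ → Ω → A}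
    (hp : M.IsSamplePath Pr X U) {δ : ℝ} (hδ : 0 < δ) {n : ℕ} (hn : 1 ≤ n) :
    ∃ E : Set Ω, MeasurableSet E ∧ 1 - δ ≤ Pr.real E ∧ ∀ ω ∈ E,
      (∀ i j k, |empiricalTensor M φ ψ (fun i => X i ω) (fun i => U i ω) n i j k -
        mode1 T (covariance M φ) i j k| ≤
          √(varianceConst dS dA M.tmix (Kmax S A HS HA) M.kappa / n / δ)) ∧
      ∀ i j, |empiricalCovariance φ (fun i => X i ω) n i j - covariance M φ i j| ≤
          √(varianceConst dS dA M.tmix (Kmax S A HS HA) M.kappa / n / δ) := by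
  have hK := hb.Kmax_nonneg
  have hκ := hb.kappa_pos
  have hn0 : (0 : ℝ) < n := by exact_mod_cast hn
  set K := Kmax S A HS HA with hKdef
  have hXU : ∀ i, Measurable fun ω => ((X i ω, U i ω), X (i + 1) ω) := fun i =>
    ((hp.1 i).prodMk (hp.2.1 i)).prodMk (hp.1 (i + 1))
  -- The entries of `F̄` and of `Σ̂` form one family, so a single Markov bound serves both.
  set g : (Fin dS × Fin dA × Fin dS) ⊕ (Fin dS × Fin dS) → (S × A) × S → ℝ :=
    Sum.elim (fun x => sampleEntry M φ ψ x.1 x.2.1 x.2.2)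
      (fun x y => φ x.1 y.1.1 * φ x.2 y.1.1) with hg
  have hgm : ∀ x, Measurable (g x) := by
    rintro (x | x)
    · exact measurable_sampleEntry φ ψ hm _ _ _
    · exact ((hm.1 (φ x.1)).comp (measurable_fst.comp measurable_fst)).mul
        ((hm.1 (φ x.2)).comp (measurable_fst.comp measurable_fst))
  have hgb : ∀ x, ∃ b, ∀ y, |g x y| ≤ b := by
    rintro (x | x)
    · exact exists_abs_sampleEntry_le φ ψ hb _ _ _
    · exact ⟨K, fun y => hb.abs_mul_le_Kmax φ x.1 x.2 _ _⟩
  set v : (Fin dS × Fin dA × Fin dS) ⊕ (Fin dS × Fin dS) → ℝ :=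
    Sum.elim (fun _ => K ^ 2 * M.kappa) (fun _ => K ^ 2) with hv
  have hgs : ∀ x s, |M.step (g x) s| ≤ K := by
    rintro (x | x) s
    · exact abs_step_sampleEntry_le φ ψ hm hb hψ _ _ _ s
    · exact M.abs_step_le (fun y => hb.abs_mul_le_Kmax φ x.1 x.2 _ _) s
  have hgv : ∀ x s, M.step (fun y => g x y ^ 2) s ≤ v x := by
    rintro (x | x) s
    · exact step_sampleEntry_sq_le φ ψ hm hb hψ _ _ _ s
    · refine (le_abs_self _).trans (M.abs_step_le (fun y => ?_) s)
      rw [abs_pow]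
      exact pow_le_pow_left₀ (abs_nonneg _) (hb.abs_mul_le_Kmax φ x.1 x.2 _ _) 2
  have hgi : ∀ x, ∫ s, M.step (g x) s ∂M.xi =
      Sum.elim (fun x => mode1 T (covariance M φ) x.1 x.2.1 x.2.2)
        (fun x => covariance M φ x.1 x.2) x := by
    rintro (x | x)
    · exact integral_step_sampleEntry φ ψ hm hb hT hψ _ _ _
    · simp [hg, Model.step, covariance]
  set Z : (Fin dS × Fin dA × Fin dS) ⊕ (Fin dS × Fin dS) → Ω → ℝ := fun x ω =>
    (n : ℝ)⁻¹ * ∑ i ∈ Finset.range n, g x ((X i ω, U i ω), X (i + 1) ω) -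
      ∫ s, M.step (g x) s ∂M.xi with hZ
  have hZm : ∀ x, Measurable (Z x) := fun x =>
    ((Finset.measurable_fun_sum _ fun i _ => (hgm x).comp (hXU i)).const_mul _).sub_const _
  have hZi : ∀ x, Integrable (fun ω => Z x ω ^ 2) Pr := fun x => by
    obtain ⟨b, hb'⟩ := hgb x
    refine integrable_of_abs_le ((hZm x).pow_const 2) (b := (b + K) ^ 2) fun ω => ?_
    rw [abs_pow]
    refine pow_le_pow_left₀ (abs_nonneg _) ((abs_sub _ _).trans (add_le_add ?_
      (abs_integral_le_of_abs_le (hgs x)))) 2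
    rw [abs_mul, abs_of_pos (inv_pos.2 hn0), inv_mul_le_iff₀ hn0]
    exact (Finset.abs_sum_le_sum_abs _ _).trans
      ((Finset.sum_le_card_nsmul _ _ b fun i _ => hb' _).trans_eq (by simp))
  have hZv : ∑ x, ∫ ω, Z x ω ^ 2 ∂Pr ≤ varianceConst dS dA M.tmix K M.kappa / n := by
    have h1 : ∀ x, ∫ ω, Z x ω ^ 2 ∂Pr ≤ (4 * v x + 300 * K ^ 2 * M.tmix ^ 2) / n := fun x => by
      obtain ⟨b, hb'⟩ := hgb x
      exact hp.integral_average_sq_le hmix (hgm x) hb' (hgv x) (hgs x) hn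
    refine (Finset.sum_le_sum fun x _ => h1 x).trans ?_
    rw [← Finset.sum_div]
    gcongr
    rw [Fintype.sum_sum_type]
    simp only [hv, Sum.elim_inl, Sum.elim_inr, Finset.sum_const, Finset.card_univ,
      Fintype.card_prod, Fintype.card_fin, nsmul_eq_mul, varianceConst]
    push_cast
    linarith
  -- The summand `1` in `varianceConst` keeps this strict even if the dimensions or `K` vanish.
  have hV : 0 < varianceConst dS dA M.tmix K M.kappa / n := by
    unfold varianceConst; positivity
  obtain ⟨E, hE, hEp, hEb⟩ := exists_event_of_second_moments hZm hZi hV hδ hZv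
  refine ⟨E, hE, hEp, fun ω hω => ⟨fun i j k => ?_, fun i j => ?_⟩⟩
  · have := hEb ω hω (Sum.inl (i, j, k))
    simp only [hZ, hgi] at this
    rw [empiricalTensor_apply]; exact this
  · have := hEb ω hω (Sum.inr (i, j))
    simp only [hZ, hgi] at this
    rw [empiricalCovariance_apply]; exact this

end Moments

/-! ### From the transition tensor to the loss -/

theorem abs_contract12_le {p q k : ℕ} (X : Tensor3 p q k) {f : Fin p → ℝ} {g : Fin q → ℝ} {b c : ℝ}
    (hf : ∀ i, |f i| ≤ b) (hg : ∀ j, |g j| ≤ c) (x : Fin k) :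
    |contract12 X f g x| ≤ ∑ i, ∑ j, |X i j x| * b * c := by
  refine (Finset.abs_sum_le_sum_abs _ _).trans (Finset.sum_le_sum fun i _ =>
    (Finset.abs_sum_le_sum_abs _ _).trans (Finset.sum_le_sum fun j _ => ?_))
  rw [abs_mul, abs_mul]
  have := (abs_nonneg _).trans (hf i)
  have := hf i
  have := hg j
  gcongr

theorem norm_sum_smul_sq {H : Type*} [NormedAddCommGroup H] [InnerProductSpace ℝ H] {d : ℕ}
    (φ : OrthonormalBasis (Fin d) ℝ H) (c : Fin d → ℝ) : ‖∑ k, c k • φ k‖ ^ 2 = ∑ k, c k ^ 2 := by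
  have e : ∑ k, c k • φ k = φ.repr.symm (WithLp.toLp 2 c) := (φ.sum_repr_symm _)
  rw [e, φ.repr.symm.norm_map, EuclideanSpace.norm_sq_eq]
  simp

section JointEmbedding

variable {S A HS HA : Type*} [NormedAddCommGroup HS] [InnerProductSpace ℝ HS] [RKHS ℝ HS S ℝ]
  [NormedAddCommGroup HA] [InnerProductSpace ℝ HA] [RKHS ℝ HA A ℝ] {dS dA : ℕ}
  (φ : OrthonormalBasis (Fin dS) ℝ HS) (ψ : Module.Basis (Fin dA) ℝ HA)

theorem jointEmbedding_eq {r l m : ℕ} (G : Tensor3 r l m) (U₁ : Matrix (Fin dS) (Fin r) ℝ)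
    (U₂ : Matrix (Fin dA) (Fin l) ℝ) (s : S) (a : A) :
    jointEmbedding φ ψ G U₁ U₂ s a =
      WithLp.toLp 2 (contract12 (mode2 (mode1 G U₁) U₂) (featureVec φ s) (featureVec ψ a)) := by
  rw [contract12_mode2, contract12_mode1]; rfl

/-- The decoded embedding depends only on the product tensor, so any factorization of `P̂` serves
and the comparison with the truth is a comparison of tensors. -/
theorem decode_jointEmbedding {r l m : ℕ} (G : Tensor3 r l m) (U₁ : Matrix (Fin dS) (Fin r) ℝ)
    (U₂ : Matrix (Fin dA) (Fin l) ℝ) (U₃ : Matrix (Fin dS) (Fin m) ℝ) (s : S) (a : A) :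
    decode φ U₃ (jointEmbedding φ ψ G U₁ U₂ s a) =
      ∑ k, contract12 (mode3 (mode2 (mode1 G U₁) U₂) U₃) (featureVec φ s) (featureVec ψ a) k •
        φ k := by
  rw [jointEmbedding_eq, contract12_mode3]; rfl

end JointEmbedding

section LowRankModel

variable {S A : Type*} [MeasurableSpace S] [MeasurableSpace A] {M : Model S A}
variable {HS : Type*} [NormedAddCommGroup HS] [InnerProductSpace ℝ HS]
  [RKHS ℝ HS S ℝ]
variable {HA : Type*} [NormedAddCommGroup HA] [InnerProductSpace ℝ HA]
  [RKHS ℝ HA A ℝ]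
variable {dS dA : ℕ} (φ : OrthonormalBasis (Fin dS) ℝ HS) (ψ : Module.Basis (Fin dA) ℝ HA)

theorem measurable_contract12_featureVec (hm : MeasurableSpaces S A HS HA) {k : ℕ}
    (X : Tensor3 dS dA k) (c : Fin k) : Measurable fun x : S × A =>
      contract12 X (featureVec φ x.1) (featureVec ψ x.2) c := by
  refine Finset.measurable_fun_sum _ fun i _ => Finset.measurable_fun_sum _ fun j _ => ?_
  exact (((hm.1 (φ i)).comp measurable_fst).const_mul _).mul ((hm.2 (ψ j)).comp measurable_snd)

theorem aestronglyMeasurable_jointEmbedding (hm : MeasurableSpaces S A HS HA) {r l m : ℕ}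
    (G : Tensor3 r l m) (U₁ : Matrix (Fin dS) (Fin r) ℝ) (U₂ : Matrix (Fin dA) (Fin l) ℝ)
    (μ : Measure (S × A)) :
    AEStronglyMeasurable (fun x : S × A => jointEmbedding φ ψ G U₁ U₂ x.1 x.2) μ := by
  simp only [jointEmbedding_eq]
  have : Measurable fun x : S × A => contract12 (mode2 (mode1 G U₁) U₂) (featureVec φ x.1)
      (featureVec ψ x.2) :=
    measurable_pi_lambda _ fun c => measurable_contract12_featureVec φ ψ hm _ c
  exact (PiLp.continuous_toLp 2 _).comp_aestronglyMeasurable this.aestronglyMeasurable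

theorem aestronglyMeasurable_sum_contract12 (hm : MeasurableSpaces S A HS HA)
    (T : Tensor3 dS dA dS) (μ : Measure (S × A)) :
    AEStronglyMeasurable (fun x : S × A =>
      ∑ k, contract12 T (featureVec φ x.1) (featureVec ψ x.2) k • φ k) μ :=
  Finset.aestronglyMeasurable_fun_sum _ fun k _ =>
    (measurable_contract12_featureVec φ ψ hm T k).aestronglyMeasurable.smul_const _

variable [CompleteSpace HS] [CompleteSpace HA]

theorem exists_abs_contract12_featureVec_le (hb : BoundedModel M HS HA) {k : ℕ}
    (X : Tensor3 dS dA k) :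
    ∃ b, ∀ s a c, |contract12 X (featureVec φ s) (featureVec ψ a) c| ≤ b := by
  obtain ⟨b, hb'⟩ := hb.exists_abs_le ψ
  refine ⟨∑ c, |∑ i, ∑ j, |X i j c| * √(Kmax S A HS HA) * b|, fun s a c => ?_⟩
  refine (abs_contract12_le X (fun i => hb.abs_le_sqrt_Kmax φ i s) (fun j => hb' j a) c).trans ?_
  exact (le_abs_self _).trans (Finset.single_le_sum
    (f := fun c => |∑ i, ∑ j, |X i j c| * √(Kmax S A HS HA) * b|) (fun _ _ => abs_nonneg _)
    (Finset.mem_univ c))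

theorem IsTransitionTensor.meanEmbedding_eq (hm : MeasurableSpaces S A HS HA)
    (hb : BoundedModel M HS HA) {T : Tensor3 dS dA dS} (hT : IsTransitionTensor M φ ψ T)
    (x : S × A) : meanEmbedding HS (M.trans x) =
      ∑ k, contract12 T (featureVec φ x.1) (featureVec ψ x.2) k • φ k := by
  rw [meanEmbedding_eq_sum φ hm.1 (fun k s => hb.abs_le_sqrt_Kmax φ k s)]
  exact Finset.sum_congr rfl fun k _ => by rw [hT x.1 x.2 k]

theorem exists_norm_jointEmbedding_le (hb : BoundedModel M HS HA) {r l m : ℕ}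
    (G : Tensor3 r l m) (U₁ : Matrix (Fin dS) (Fin r) ℝ) (U₂ : Matrix (Fin dA) (Fin l) ℝ) :
    ∃ b, ∀ x : S × A, ‖jointEmbedding φ ψ G U₁ U₂ x.1 x.2‖ ≤ b := by
  obtain ⟨b, hb'⟩ := exists_abs_contract12_featureVec_le φ ψ hb (mode2 (mode1 G U₁) U₂)
  refine ⟨m * b, fun x => ?_⟩
  rw [jointEmbedding_eq]
  exact (norm_le_sum_abs _).trans
    ((Finset.sum_le_card_nsmul _ _ b fun c _ => hb' x.1 x.2 c).trans_eq (by simp))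

theorem exists_norm_sum_contract12_le (hb : BoundedModel M HS HA) (T : Tensor3 dS dA dS) :
    ∃ b, ∀ x : S × A, ‖∑ k, contract12 T (featureVec φ x.1) (featureVec ψ x.2) k • φ k‖ ≤ b := by
  obtain ⟨b, hb'⟩ := exists_abs_contract12_featureVec_le φ ψ hb T
  refine ⟨dS * b, fun x => ?_⟩
  refine (norm_sum_le _ _).trans ((Finset.sum_le_card_nsmul _ _ b fun k _ => ?_).trans_eq (by simp))
  rw [norm_smul, φ.norm_eq_one, mul_one]
  exact hb' x.1 x.2 k

/-- Entrywise closeness of two tensors bounds the mean square distance of the embeddings. -/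
theorem integral_norm_sum_contract12_sub_sq_le (hm : MeasurableSpaces S A HS HA)
    (hb : BoundedModel M HS HA) (hψ : IsL2Orthonormal M ψ) {T T' : Tensor3 dS dA dS} {γ : ℝ}
    (hγ : ∀ i j k, |T' i j k - T i j k| ≤ γ) :
    ∫ x, ‖∑ k, contract12 T (featureVec φ x.1) (featureVec ψ x.2) k • φ k -
      ∑ k, contract12 T' (featureVec φ x.1) (featureVec ψ x.2) k • φ k‖ ^ 2 ∂(M.xi.prod M.eta) ≤
      dS ^ 3 * dA ^ 2 * Kmax S A HS HA * γ ^ 2 := by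
  have hK := hb.Kmax_nonneg
  -- Cauchy–Schwarz over index pairs costs `dS * dA`; the sums over `i` and `k` give two more
  -- factors `dS`. The squares of `ψ` stay unevaluated, since only their `η`-means are known; those
  -- supply the last `dA`.
  have hpt : ∀ x : S × A, ‖∑ k, contract12 T (featureVec φ x.1) (featureVec ψ x.2) k • φ k -
      ∑ k, contract12 T' (featureVec φ x.1) (featureVec ψ x.2) k • φ k‖ ^ 2 ≤
      dS ^ 3 * dA * Kmax S A HS HA * γ ^ 2 * ∑ j, ψ j x.2 * ψ j x.2 := fun x => by
    rw [← Finset.sum_sub_distrib]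
    simp only [← sub_smul]
    rw [norm_sum_smul_sq]
    have hk : ∀ k, (contract12 T (featureVec φ x.1) (featureVec ψ x.2) k -
        contract12 T' (featureVec φ x.1) (featureVec ψ x.2) k) ^ 2 ≤
        dS ^ 2 * dA * Kmax S A HS HA * γ ^ 2 * ∑ j, ψ j x.2 * ψ j x.2 := fun k => by
      have e : contract12 T (featureVec φ x.1) (featureVec ψ x.2) k -
          contract12 T' (featureVec φ x.1) (featureVec ψ x.2) k =
          ∑ y : Fin dS × Fin dA, (T y.1 y.2 k - T' y.1 y.2 k) * φ y.1 x.1 * ψ y.2 x.2 := by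
        simp only [contract12, featureVec, Fintype.sum_prod_type, sub_mul, Finset.sum_sub_distrib]
      rw [e]
      refine sq_sum_le_card_mul_sum_sq.trans ?_
      rw [Fintype.sum_prod_type]
      have h1 : ∀ i : Fin dS, ∑ j : Fin dA,
          ((T i j k - T' i j k) * φ i x.1 * ψ j x.2) ^ 2 ≤
          γ ^ 2 * Kmax S A HS HA * ∑ j, ψ j x.2 * ψ j x.2 := fun i => by
        rw [Finset.mul_sum]
        refine Finset.sum_le_sum fun j _ => ?_
        rw [mul_pow, mul_pow, sq (ψ j x.2)]
        have h2 : (T i j k - T' i j k) ^ 2 ≤ γ ^ 2 := by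
          rw [← sq_abs, abs_sub_comm]
          exact pow_le_pow_left₀ (abs_nonneg _) (hγ i j k) 2
        have h3 := hb.sq_le_Kmax φ i x.1
        have h4 := mul_self_nonneg (ψ j x.2)
        gcongr
      refine (mul_le_mul_of_nonneg_left (Finset.sum_le_sum fun i _ => h1 i)
        (by positivity)).trans_eq ?_
      simp; ring
    refine (Finset.sum_le_sum fun k _ => hk k).trans_eq ?_
    simp; ring
  have hi : ∀ j, Integrable (fun x : S × A => ψ j x.2 * ψ j x.2) (M.xi.prod M.eta) := fun j =>
    (integrable_psi_mul_psi ψ hm hb j j).comp_snd M.xi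
  refine (integral_mono_of_nonneg (.of_forall fun x => sq_nonneg _)
    ((integrable_finsetSum _ fun j _ => hi j).const_mul _) (.of_forall hpt)).trans_eq ?_
  rw [integral_const_mul, integral_finsetSum _ fun j _ => hi j]
  have h1 : ∀ j, ∫ x : S × A, ψ j x.2 * ψ j x.2 ∂(M.xi.prod M.eta) = 1 := fun j => by
    rw [integral_fun_snd (fun a => ψ j a * ψ j a), hψ j j]; simp
  simp only [h1]
  simp; ring

/-! ### Nondegeneracy -/

theorem abs_dotProduct_le {d : ℕ} {u : EuclideanSpace ℝ (Fin d)} (hu : ‖u‖ = 1) {f : Fin d → ℝ}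
    {b : ℝ} (hf : ∀ i, |f i| ≤ b) : |u ⬝ᵥ f| ≤ d * b := by
  refine (Finset.abs_sum_le_sum_abs _ _).trans
    ((Finset.sum_le_card_nsmul _ _ b fun i _ => ?_).trans_eq (by simp))
  rw [abs_mul]
  have := hu ▸ abs_apply_le_norm u i
  exact (mul_le_mul this (hf i) (abs_nonneg _) zero_le_one).trans_eq (one_mul b)

theorem integral_sq_le_lambdaBar (hb : BoundedModel M HS HA) (i : Fin dS) (j : Fin dA)
    (k : Fin dS) :
    ∫ y : (S × A) × S, (φ i y.1.1 * ψ j y.1.2 * φ k y.2) ^ 2 ∂((M.xi.prod M.eta) ⊗ₘ M.trans) ≤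
      lambdaBar M φ ψ := by
  obtain ⟨c, hc⟩ := hb.exists_abs_le ψ
  refine le_csSup ⟨(dS * √(Kmax S A HS HA) * (dA * c) * (dS * √(Kmax S A HS HA))) ^ 2, ?_⟩
    ⟨EuclideanSpace.single i 1, EuclideanSpace.single j 1, EuclideanSpace.single k 1,
      by simp, by simp, by simp, by simp [featureVec]⟩
  rintro _ ⟨u, v, w, hu, hv, hw, rfl⟩
  refine (le_abs_self _).trans (abs_integral_le_of_abs_le fun y => ?_)
  rw [abs_pow, abs_mul, abs_mul]
  have h1 := abs_dotProduct_le hu (f := featureVec φ y.1.1)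
    (fun i => hb.abs_le_sqrt_Kmax φ i y.1.1)
  have h2 := abs_dotProduct_le hv (f := featureVec ψ y.1.2) (fun j => hc j y.1.2)
  have h3 := abs_dotProduct_le hw (f := featureVec φ y.2) (fun i => hb.abs_le_sqrt_Kmax φ i y.2)
  have h4 := (abs_nonneg _).trans h2
  gcongr

/-- Otherwise all products `φ i ψ j φ k` have zero second moment and vanish almost everywhere. Their
means are the entries of `T ×₁ Σ`, and invertibility of `Σ` would force `T = 0`. -/
theorem lambdaBar_pos (hm : MeasurableSpaces S A HS HA) (hb : BoundedModel M HS HA)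
    {T : Tensor3 dS dA dS} (hT : IsTransitionTensor M φ ψ T) (hψ : IsL2Orthonormal M ψ)
    (hcov : IsUnit (covariance M φ)) (hT0 : T ≠ 0) : 0 < lambdaBar M φ ψ := by
  by_contra! hle
  refine hT0 ?_
  have hF : mode1 T (covariance M φ) = 0 := by
    funext i j k
    obtain ⟨c, hc⟩ := hb.exists_abs_le ψ
    set f : (S × A) × S → ℝ := fun y => φ i y.1.1 * ψ j y.1.2 * φ k y.2 with hf
    have hfm : Measurable f :=
      (((hm.1 (φ i)).comp (measurable_fst.comp measurable_fst)).mul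
        ((hm.2 (ψ j)).comp (measurable_snd.comp measurable_fst))).mul
        ((hm.1 (φ k)).comp measurable_snd)
    have hfb : ∀ y, |f y| ≤ Kmax S A HS HA * c := fun y => by
      rw [hf]; simp only
      rw [mul_right_comm, abs_mul]
      exact mul_le_mul (hb.abs_mul_le_Kmax φ i k _ _) (hc _ _) (abs_nonneg _) hb.Kmax_nonneg
    have hfi : Integrable f ((M.xi.prod M.eta) ⊗ₘ M.trans) := integrable_of_abs_le hfm hfb
    have h0 : ∫ y, f y ^ 2 ∂((M.xi.prod M.eta) ⊗ₘ M.trans) = 0 :=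
      le_antisymm ((integral_sq_le_lambdaBar φ ψ hb i j k).trans hle)
        (integral_nonneg fun _ => sq_nonneg _)
    rw [integral_eq_zero_iff_of_nonneg (fun _ => sq_nonneg _)
      (integrable_of_abs_le (hfm.pow_const 2) (b := (Kmax S A HS HA * c) ^ 2) fun y => by
        rw [abs_pow]; exact pow_le_pow_left₀ (abs_nonneg _) (hfb y) 2)] at h0
    have h1 : ∫ y, f y ∂((M.xi.prod M.eta) ⊗ₘ M.trans) = 0 := by
      rw [integral_eq_zero_of_ae]
      filter_upwards [h0] with y hy
      exact pow_eq_zero_iff (two_ne_zero) |>.1 hy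
    rw [Measure.integral_compProd hfi, integral_prod _ (integrable_of_abs_le
      (M.measurable_inner_step hfm) fun _ => abs_integral_le_of_abs_le fun _ => hfb _)] at h1
    rw [← integral_step_sampleEntry φ ψ hm hb hT hψ]
    simp only [step_sampleEntry_eq_integral φ ψ, ← integral_const_mul]
    exact h1
  rw [← mode1_inv_mode1 hcov T, hF]
  funext i j k
  simp [mode1]

end LowRankModel

/-- Turns the assumption `σ > 0` into `P ≠ 0`. -/
theorem sliceSingularValue_zero (p q k m : ℕ) : sliceSingularValue (0 : Tensor3 p q k) m = 0 := by
  have h : ∀ w : Fin p → ℝ, slice1 (0 : Tensor3 p q k) w = 0 := fun w => by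
    ext j c; simp [slice1]
  refine le_antisymm (Real.sSup_le ?_ le_rfl) (Real.sSup_nonneg ?_)
  · rintro _ ⟨w, -, rfl⟩
    rw [h]; simp
  · rintro _ ⟨w, -, rfl⟩
    rw [h]; simp

/-! ### The sample size threshold -/

/-- The factor by which an entrywise error of `F̄` and `Σ̂` is amplified in `P̂`. -/
noncomputable def amplification (dS dA : ℕ) (sInv K : ℝ) : ℝ :=
  dS * ((dS * dA * dS + 1 + dS * (dS * (K * sInv))) * (2 * sInv))

/-- As `n` grows the entrywise error tends to zero, which secures invertibility of `Σ̂`, while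
`log²(n / t)` exceeds any constant. The sign conditions come after `N`, so that choosing `N` gives a
function of the numbers alone. -/
theorem exists_threshold (dS dA t : ℕ) (sInv muB K kap lam δ : ℝ) :
    ∃ N : ℕ, 0 < sInv → 0 ≤ muB → 0 < kap → 0 < lam → 1 ≤ t → 0 < δ → δ < 1 → ∀ n, N ≤ n →
      1 ≤ n ∧ sInv * (dS ^ 2 * √(varianceConst dS dA t K kap / n / δ)) ≤ 1 / 2 ∧
      6 * (dS ^ 3 * dA ^ 2 * K * (amplification dS dA sInv K ^ 2 *
        (varianceConst dS dA t K kap / δ))) ≤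
        sInv * (lam * (Real.log (2 * t / δ) + dS + dA) * (kap + muB * sInv ^ 2)) * t *
          Real.log (n / t) ^ 2 := by
  by_cases h : 0 < sInv ∧ 0 ≤ muB ∧ 0 < kap ∧ 0 < lam ∧ 1 ≤ t ∧ 0 < δ ∧ δ < 1
  swap
  · exact ⟨0, fun h1 h2 h3 h4 h5 h6 h7 => absurd ⟨h1, h2, h3, h4, h5, h6, h7⟩ h⟩
  obtain ⟨h1, h2, h3, h4, h5, h6, h7⟩ := h
  have ht : (1 : ℝ) ≤ t := by exact_mod_cast h5
  have hlog : 0 < Real.log (2 * t / δ) :=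
    Real.log_pos (by rw [lt_div_iff₀ h6]; linarith)
  have hc : 0 < sInv * (lam * (Real.log (2 * t / δ) + dS + dA) * (kap + muB * sInv ^ 2)) * t := by
    positivity
  have hn : Filter.Tendsto (fun n : ℕ => (n : ℝ)) Filter.atTop Filter.atTop :=
    tendsto_natCast_atTop_atTop
  have l1 : Filter.Tendsto (fun n : ℕ =>
      sInv * (dS ^ 2 * √(varianceConst dS dA t K kap / n / δ))) Filter.atTop (nhds 0) := by
    have h0 : Filter.Tendsto (fun n : ℕ => √(varianceConst dS dA t K kap / n / δ)) Filter.atTop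
        (nhds 0) := by
      have := ((tendsto_const_nhds (x := varianceConst dS dA t K kap)).div_atTop hn).div_const δ
      rw [zero_div] at this
      simpa [Function.comp_def] using (Real.continuous_sqrt.tendsto 0).comp this
    simpa using (h0.const_mul ((dS : ℝ) ^ 2)).const_mul sInv
  have l2 : Filter.Tendsto (fun n : ℕ =>
      sInv * (lam * (Real.log (2 * t / δ) + dS + dA) * (kap + muB * sInv ^ 2)) * t *
        Real.log (n / t) ^ 2) Filter.atTop Filter.atTop :=
    ((Filter.tendsto_pow_atTop two_ne_zero).comp (Real.tendsto_log_atTop.comp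
      (hn.atTop_div_const (by linarith)))).const_mul_atTop hc
  obtain ⟨N, hN⟩ := Filter.eventually_atTop.1 ((Filter.eventually_ge_atTop 1).and
    ((l1.eventually_le_const (by norm_num : (0 : ℝ) < 1 / 2)).and
      (l2.eventually_ge_atTop _)))
  exact ⟨N, fun _ _ _ _ _ _ _ n hn => hN n hn⟩

/-! ### Assembly of the loss bound. -/

section Main

variable {S A : Type*} [MeasurableSpace S] [MeasurableSpace A] {M : Model S A}
variable {HS : Type*} [NormedAddCommGroup HS] [InnerProductSpace ℝ HS] [CompleteSpace HS]
  [RKHS ℝ HS S ℝ]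
variable {HA : Type*} [NormedAddCommGroup HA] [InnerProductSpace ℝ HA] [CompleteSpace HA]
  [RKHS ℝ HA A ℝ]
variable {dS dA : ℕ} (φ : OrthonormalBasis (Fin dS) ℝ HS) (ψ : Module.Basis (Fin dA) ℝ HA)

/-- The index `i` excludes dimension zero, where the inverse has norm zero. -/
theorem specNorm_inv_pos {d : ℕ} {T : Matrix (Fin d) (Fin d) ℝ} (hT : IsUnit T) (i : Fin d) :
    0 < specNorm T⁻¹ := by
  refine (specNorm_nonneg _).lt_of_ne fun h => ?_
  have h0 : T⁻¹ = 0 := by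
    ext a b
    have := abs_entry_le_specNorm T⁻¹ a b
    rw [← h] at this
    exact abs_nonpos_iff.1 this
  have h1 := Matrix.mul_nonsing_inv _ ((Matrix.isUnit_iff_isUnit_det T).1 hT)
  rw [h0, mul_zero] at h1
  simpa using congrFun (congrFun h1 i) i

theorem ranks_pos_of_transitionTensor_ne_zero {r l m : ℕ}
    (h : OperatorTuckerRankLE M HS HA r l m) (hT : transitionTensor M φ ψ ≠ 0) :
    0 < r ∧ 0 < l ∧ 0 < m := by
  obtain ⟨G, U₁, U₂, U₃, hG⟩ := exists_transitionTensor_eq φ ψ h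
  refine ⟨?_, ?_, ?_⟩ <;>
  · rw [Nat.pos_iff_ne_zero]
    rintro rfl
    refine hT (hG.trans ?_)
    funext i j k
    simp [mode1, mode2, mode3]

/-- The maximum of positive integers is at most their product, so the rank and conditioning factors
can only enlarge `s`. -/
theorem le_mul_div_max {r l m : ℕ} (hr : 0 < r) (hl : 0 < l) (hm : 0 < m) {s x : ℝ} (hs : 0 ≤ s)
    (hx : 1 ≤ x) : s ≤ s * ((r * l * m : ℕ) : ℝ) * x / (max r (max l m) : ℕ) := by
  have hmax : 0 < max r (max l m) := lt_max_of_lt_left hr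
  rw [le_div_iff₀ (by exact_mod_cast hmax)]
  have hle : max r (max l m) ≤ r * l * m := by
    refine max_le ?_ (max_le ?_ ?_)
    · rw [mul_assoc]; exact Nat.le_mul_of_pos_right _ (Nat.mul_pos hl hm)
    · rw [mul_comm r l, mul_assoc]; exact Nat.le_mul_of_pos_right _ (Nat.mul_pos hr hm)
    · exact Nat.le_mul_of_pos_left _ (Nat.mul_pos hr hl)
  have hle' : ((max r (max l m) : ℕ) : ℝ) ≤ ((r * l * m : ℕ) : ℝ) := by exact_mod_cast hle
  have h0 : (0 : ℝ) ≤ ((r * l * m : ℕ) : ℝ) := Nat.cast_nonneg _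
  calc s * ((max r (max l m) : ℕ) : ℝ) ≤ s * ((r * l * m : ℕ) : ℝ) := by gcongr
    _ ≤ s * ((r * l * m : ℕ) : ℝ) * x := le_mul_of_one_le_right (by positivity) hx

/-- The loss of the estimated clustering when `F̄` and `Σ̂` are entrywise within `ε` of their
targets. -/
theorem partitionLoss_le_of_abs_sub_le (hm : MeasurableSpaces S A HS HA)
    (hb : BoundedModel M HS HA) {r l m ns na : ℕ} (hop : OperatorTuckerRankLE M HS HA r l m)
    (hψ : IsL2Orthonormal M ψ) (hcov : IsUnit (covariance M φ)) {ε : ℝ} (hε : 0 ≤ ε)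
    (hsmall : specNorm (covariance M φ)⁻¹ * (dS ^ 2 * ε) ≤ 1 / 2)
    {Fbar Fhat : Tensor3 dS dA dS} {Shat : Matrix (Fin dS) (Fin dS) ℝ}
    (hF : ∀ i j k, |Fbar i j k - mode1 (transitionTensor M φ ψ) (covariance M φ) i j k| ≤ ε)
    (hS : ∀ i j, |Shat i j - covariance M φ i j| ≤ ε)
    {G : Tensor3 r l m} {U₁ : Matrix (Fin dS) (Fin r) ℝ} {U₂ : Matrix (Fin dA) (Fin l) ℝ}
    {U₃ : Matrix (Fin dS) (Fin m) ℝ} {P : Fin ns → Set S} {Q : Fin na → Set A}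
    {z : Fin ns → Fin na → EuclideanSpace ℝ (Fin m)} (hFhat : IsLowRankApprox Fbar r l m Fhat)
    (hG : IsTuckerFactorization (mode1 Fhat Shat⁻¹) G U₁ U₂ U₃)
    (hz : IsClusterSolution M (jointEmbedding φ ψ G U₁ U₂) P Q z) :
    partitionLoss M P Q (fun i j => decode φ U₃ (z i j)) ≤
      6 * (dS ^ 3 * dA ^ 2 * Kmax S A HS HA *
        (amplification dS dA (specNorm (covariance M φ)⁻¹) (Kmax S A HS HA) * ε) ^ 2) +
      4 * optimalLoss M HS ns na := by
  have hT := isTransitionTensor_transitionTensor φ ψ hop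
  obtain ⟨G', V₁, V₂, V₃, hG'⟩ := exists_transitionTensor_eq φ ψ hop
  set T := transitionTensor M φ ψ with hTdef
  set K := Kmax S A HS HA with hKdef
  set F := mode1 T (covariance M φ) with hFdef
  have hFrank : TuckerRankLE F r l m := by
    rw [hFdef, hG', mode1_mode3, mode1_mode2, mode1_mode1]
    exact tuckerRankLE_mode _ _ _ _
  have hFb : ∀ i j k, |F i j k| ≤ K := abs_mode1_covariance_le φ ψ hm hb hT hψ
  have hFinv : mode1 F (covariance M φ)⁻¹ = T := mode1_inv_mode1 hcov T
  have hΔ : ∀ i j k, |mode1 Fhat Shat⁻¹ i j k - T i j k| ≤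
      amplification dS dA (specNorm (covariance M φ)⁻¹) K * ε := fun i j k => by
    have := abs_mode1_inv_sub_le hcov hε hFb (hFhat.abs_sub_le hFrank hF) hS hsmall i j k
    rw [hFinv] at this
    refine this.trans_eq ?_
    unfold amplification; ring
  obtain ⟨hU₁, hU₂, hU₃, hPhat⟩ := hG
  obtain ⟨J, hJ⟩ := exists_decode_isometry φ hU₃
  obtain ⟨b, hΦb⟩ := exists_norm_jointEmbedding_le φ ψ hb G U₁ U₂
  obtain ⟨c, hTb⟩ := exists_norm_sum_contract12_le φ ψ hb T
  have hmean := hT.meanEmbedding_eq φ ψ hm hb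
  have key := hz.partitionLoss_le J
    (aestronglyMeasurable_jointEmbedding φ ψ hm G U₁ U₂ _) hΦb
    (by simp only [hmean]; exact aestronglyMeasurable_sum_contract12 φ ψ hm T _)
    (c := c) (by simp only [hmean]; exact hTb)
  simp only [hJ, decode_jointEmbedding, ← hPhat, hmean] at key
  have hint := integral_norm_sum_contract12_sub_sq_le φ ψ hm hb hψ hΔ
  linarith

end Main

end TensorMDP

theorem theorem3 :
    ∃ (C : ℝ) (N : (dS dA t : ℕ) → (sInv muB K kap lam δ : ℝ) → ℕ), 0 < C ∧
      ∀ {S A : Type*} [MeasurableSpace S] [MeasurableSpace A]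
        {HS : Type*} [NormedAddCommGroup HS] [InnerProductSpace ℝ HS] [CompleteSpace HS]
        [RKHS ℝ HS S ℝ]
        {HA : Type*} [NormedAddCommGroup HA] [InnerProductSpace ℝ HA] [CompleteSpace HA]
        [RKHS ℝ HA A ℝ]
        (M : TensorMDP.Model S A) (dS dA r l m ns na : ℕ)
        (φ : OrthonormalBasis (Fin dS) ℝ HS) (ψ : Module.Basis (Fin dA) ℝ HA) (δ : ℝ),
        0 < δ → δ < 1 →
        TensorMDP.MeasurableSpaces S A HS HA →
        TensorMDP.BoundedModel M HS HA →
        M.HasFiniteMixingTime →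
        TensorMDP.OperatorTuckerRankLE M HS HA r l m →
        TensorMDP.IsL2Orthonormal M ψ →
        IsUnit (TensorMDP.covariance M φ) →
        0 < TensorMDP.sliceSingularValue (TensorMDP.transitionTensor M φ ψ) m →
        ∀ {Ω : Type*} [MeasurableSpace Ω] (Pr : Measure Ω) [IsProbabilityMeasure Pr]
          (X : ℕ → Ω → S) (U : ℕ → Ω → A),
          M.IsSamplePath Pr X U →
          ∀ n : ℕ,
            N dS dA M.tmix (TensorMDP.specNorm (TensorMDP.covariance M φ)⁻¹)
              (TensorMDP.muBar M φ) (TensorMDP.Kmax S A HS HA) M.kappa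
              (TensorMDP.lambdaBar M φ ψ) δ ≤ n →
            ∃ E : Set Ω, MeasurableSet E ∧ 1 - δ ≤ Pr.real E ∧ ∀ ω ∈ E,
              ∀ (Fhat : TensorMDP.Tensor3 dS dA dS) (G : TensorMDP.Tensor3 r l m)
                (U₁ : Matrix (Fin dS) (Fin r) ℝ) (U₂ : Matrix (Fin dA) (Fin l) ℝ)
                (U₃ : Matrix (Fin dS) (Fin m) ℝ)
                (P : Fin ns → Set S) (Q : Fin na → Set A)
                (z : Fin ns → Fin na → EuclideanSpace ℝ (Fin m)),
                TensorMDP.IsLowRankApprox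
                  (TensorMDP.empiricalTensor M φ ψ (fun i => X i ω) (fun i => U i ω) n)
                  r l m Fhat →
                TensorMDP.IsTuckerFactorization
                  (TensorMDP.mode1 Fhat
                    (TensorMDP.empiricalCovariance φ (fun i => X i ω) n)⁻¹) G U₁ U₂ U₃ →
                TensorMDP.IsClusterSolution M (TensorMDP.jointEmbedding φ ψ G U₁ U₂) P Q z →
                TensorMDP.partitionLoss M P Q (fun i j => TensorMDP.decode φ U₃ (z i j)) ≤
                  C * (TensorMDP.specNorm (TensorMDP.covariance M φ)⁻¹ *
                      ((r * l * m : ℕ) : ℝ) *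
                      (1 + 2 * TensorMDP.lambdaBar M φ ψ *
                        TensorMDP.specNorm (TensorMDP.covariance M φ)⁻¹ ^ 2 /
                        TensorMDP.sliceSingularValue (TensorMDP.transitionTensor M φ ψ) m ^ 2) /
                      (max r (max l m) : ℕ)) *
                    TensorMDP.squaredRate M φ ψ δ n +
                  4 * TensorMDP.optimalLoss M HS ns na := by
  -- The threshold is fixed before any model is introduced, hence depends on the listed numbers
  -- only.
  choose N hN using TensorMDP.exists_threshold
  refine ⟨1, N, one_pos, ?_⟩
  intro S A _ _ HS _ _ _ _ HA _ _ _ _ M dS dA r l m ns na φ ψ δ hδ hδ1 hm hb hmix hop hψ hcov hσ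
    Ω _ Pr _ X U hp n hn
  have hT := TensorMDP.isTransitionTensor_transitionTensor φ ψ hop
  have hT0 : TensorMDP.transitionTensor M φ ψ ≠ 0 := fun h => by
    rw [h, TensorMDP.sliceSingularValue_zero] at hσ
    exact lt_irrefl _ hσ
  obtain ⟨hr, hl, hmpos⟩ := TensorMDP.ranks_pos_of_transitionTensor_ne_zero φ ψ hop hT0
  -- A nonzero tensor has an index, so `dS` is positive.
  obtain ⟨i₀, -⟩ : ∃ i, TensorMDP.transitionTensor M φ ψ i ≠ 0 := Function.ne_iff.1 hT0
  have hs := TensorMDP.specNorm_inv_pos hcov i₀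
  have hlam := TensorMDP.lambdaBar_pos φ ψ hm hb hT hψ hcov hT0
  have hκ := hb.kappa_pos
  have hμ : 0 ≤ TensorMDP.muBar M φ := TensorMDP.specNorm_nonneg _
  have hK := hb.Kmax_nonneg
  have ht := hmix.one_le_tmix
  obtain ⟨hn1, hsmall, hrate⟩ := hN dS dA M.tmix _ _ (TensorMDP.Kmax S A HS HA) _ _ δ hs hμ hκ hlam
    ht hδ hδ1 n hn
  obtain ⟨E, hE, hEp, hEb⟩ := TensorMDP.exists_concentration_event φ ψ hm hb hT hψ hmix hp hδ hn1
  refine ⟨E, hE, hEp, fun ω hω Fhat G U₁ U₂ U₃ P Q z hFhat hG hz => ?_⟩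
  obtain ⟨hF, hS⟩ := hEb ω hω
  refine (TensorMDP.partitionLoss_le_of_abs_sub_le φ ψ hm hb hop hψ hcov (Real.sqrt_nonneg _)
    hsmall hF hS hFhat hG hz).trans (add_le_add ?_ le_rfl)
  have hn0 : (0 : ℝ) < n := by exact_mod_cast hn1
  have ht0 : (0 : ℝ) < M.tmix := by exact_mod_cast ht
  have hV : 0 ≤ TensorMDP.varianceConst dS dA M.tmix (TensorMDP.Kmax S A HS HA) M.kappa := by
    unfold TensorMDP.varianceConst; positivity
  have hlog : 0 ≤ Real.log (2 * M.tmix / δ) := by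
    refine Real.log_nonneg ?_
    rw [le_div_iff₀ hδ]
    have : (1 : ℝ) ≤ M.tmix := by exact_mod_cast ht
    linarith
  set s := TensorMDP.specNorm (TensorMDP.covariance M φ)⁻¹
  set B := TensorMDP.lambdaBar M φ ψ * (Real.log (2 * M.tmix / δ) + dS + dA) *
    (M.kappa + TensorMDP.muBar M φ * s ^ 2) with hB
  have hB0 : 0 ≤ B := by positivity
  have hsq : TensorMDP.squaredRate M φ ψ δ n = B * M.tmix * Real.log (n / M.tmix) ^ 2 / n := by
    rw [TensorMDP.squaredRate, ← hB, ← div_div, div_inv_eq_mul]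
    field_simp
  have hsq0 : 0 ≤ TensorMDP.squaredRate M φ ψ δ n := by rw [hsq]; positivity
  have hfac := TensorMDP.le_mul_div_max hr hl hmpos hs.le (x := 1 + 2 * TensorMDP.lambdaBar M φ ψ *
    s ^ 2 / TensorMDP.sliceSingularValue (TensorMDP.transitionTensor M φ ψ) m ^ 2)
    (le_add_of_nonneg_right (by positivity))
  rw [one_mul]
  refine le_trans ?_ (mul_le_mul_of_nonneg_right hfac hsq0)
  -- Since `ε² = V / (n δ)`, both sides carry the factor `1 / n`; clearing it leaves the inequality
  -- guaranteed by the threshold.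
  rw [hsq, mul_pow, Real.sq_sqrt (by positivity), ← mul_div_assoc s, le_div_iff₀ hn0]
  refine le_trans (le_of_eq ?_) (hrate.trans_eq (by ring))
  field_simp
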